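/- **Setting.** Let $G$ be a compact Hausdorff second countable group and let $M$ be a type III factor with separable predual, regarded as a von Neumann algebra on $L^2(M)$ in standard form, with modular conjugation $J$ and right action $\xi\cdot n=Jn^*J\xi$. The right action of $M$ on $L^2(M)\otimes\mathcal K$ is $(\xi\otimes f)\cdot n=(\xi\cdot n)\otimes f$. Let $\operatorname{Aut}(M)$ carry the Borel structure of the $u$-topology and let $\operatorname{Out}(M)=\operatorname{Aut}(M)/\{\operatorname{Ad}v: v\in \mathsf U(M)\}$. A *$G$-kernel* is an injective homomorphism $\theta\colon G\to\operatorname{Out}(M)$ that has a *Borel lift*, i.e. a Borel map $\alpha\colon G\to\operatorname{Aut}(M)$ with $[\alpha_g]=\theta_g$ for all $g$. The objects of $\operatorname{End}(M)$ are the normal unital $*$-endomorphisms of $M$, its morphisms are $(\rho,\sigma)=\{T\in M: T\rho(m)=\sigma(m)T\ \ \forall m\in M\}$, with composition given by multiplication and with involution $T\mapsto T^*$. A *concrete $C(G)$-module* is given by a triple $X=(X,\mu_X,g_X)$ of a topological space $X$, a nonzero finite Borel measure $\mu_X$ on it with $L^2X=L^2(X,\mu_X)$ separable, and a Borel map $g_X\colon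 X\to G$; $C(G)$ acts on $L^2X$ by $f\cdot\xi=(f\circ g_X)\,\xi$. The morphisms $X\to Y$ are the bounded $C(G)$-equivariant linear maps $t\colon L^2X\to L^2Y$, with involution $t\mapsto t^*$. Write $\operatorname{Rep}_{\mathrm{concrete}}(C(G))$ for this category. Let $\theta$ be a $G$-kernel on $M$ with a Borel lift $\alpha$. For a triple $X$ let $$\sigma_X(m)=\int_X\alpha_{g_X(x)}(m)\otimes \mathrm dE_X(x)\in B(L^2(M)\otimes L^2X),\qquad m\in M,$$ where $E_X(A)$ is multiplication by $1_A$ on $L^2X$; that is, for all $\xi,\eta\in L^2(M)$ and $f,h\in L^2X$, $$\langle \eta\otimes h,\sigma_X(m)(\xi\otimes f)\rangle=\int_X\langle\eta,\alpha_{g_X(x)}(m)\xi\rangle\,\overline{h(x)}f(x)\,\mathrm d\mu_X(x)$$ (inner products linear in the second variable). For a finite Borel measure $\mu$ on $G$, call a Borel set $E\subseteq G$ *proper* if $\mu(E)>0$ and $\mu(G\setminus E)>0$, let $\mu_E(A)=\mu(A\cap E)$, and write $\rho_{\mu_E}$ for the endomorphism $\rho_X$ below attached to $X=(G,\mu_E,\mathrm{id})$.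 Say that the lift $\alpha$ satisfies $(*)$ if for every finite Borel measure $\mu$ on $G$ and all proper Borel sets $E,F\subseteq G$ with $\mu(E\cap F)=0$ one has $(\rho_{\mu_E},\rho_{\mu_F})=0$, for every choice of the unitaries that define $\rho_{\mu_E}$ and $\rho_{\mu_F}$. The $G$-kernel $\theta$ is called *minimal* if some Borel lift of $\theta$ satisfies $(*)$. **Theorem.** For every triple $X$ there is a unitary right $M$-modular map $U_X\colon L^2(M)\otimes L^2X\to L^2(M)$. For every choice of such unitaries $U_X$, one for each triple $X$, put $\rho_X(m)=U_X\sigma_X(m)U_X^*$. Then the following hold. 1. $\rho_X$ belongs to $\operatorname{End}(M)$ for every $X$, and $$F(X)=\rho_X,\qquad F(t)=U_Y(1\otimes t)U_X^*\quad (t\colon X\to Y)$$ define a functor $F\colon\operatorname{Rep}_{\mathrm{concrete}}(C(G))\to\operatorname{End}(M)$ that is unitary, i.e. $\mathbb C$-linear on morphisms with $F(t^*)=F(t)^*$. 2. $F$ is faithful. 3. If $F$ is full, then the lift $\alpha$ satisfies $(*)$; in particular the $G$-kernel $\theta$ is minimal. -/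

import Mathlib

open CategoryTheory MeasureTheory TensorProduct
open scoped ENNReal InnerProductSpace

set_option linter.unusedSectionVars false

universe u v w

noncomputable section

/-! ### Hilbert space tensor products -/

section HilbertTensor

variable {H K L : Type*}
  [NormedAddCommGroup H] [InnerProductSpace ℂ H]
  [NormedAddCommGroup K] [InnerProductSpace ℂ K]
  [NormedAddCommGroup L] [InnerProductSpace ℂ L]

/-- The Hilbert space tensor product: the completion of the algebraic tensor product with
`⟪ξ ⊗ f, η ⊗ h⟫ = ⟪ξ, η⟫ ⟪f, h⟫`. -/
abbrev HilbertTensor (H K : Type*) [NormedAddCommGroup H] [InnerProductSpace ℂ H]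
    [NormedAddCommGroup K] [InnerProductSpace ℂ K] : Type _ :=
  UniformSpace.Completion (H ⊗[ℂ] K)

/-- The elementary tensor `ξ ⊗ f`. -/
def HilbertTensor.tmul (ξ : H) (f : K) : HilbertTensor H K :=
  ((ξ ⊗ₜ[ℂ] f : H ⊗[ℂ] K) : UniformSpace.Completion (H ⊗[ℂ] K))

/-- The operator `1 ⊗ t`. -/
def HilbertTensor.lmap (H : Type*) [NormedAddCommGroup H] [InnerProductSpace ℂ H]
    (t : K →L[ℂ] L) : HilbertTensor H K →L[ℂ] HilbertTensor H L :=
  (t.lTensor H).completion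

/-- The operator `a ⊗ 1`. -/
def HilbertTensor.rmap (K : Type*) [NormedAddCommGroup K] [InnerProductSpace ℂ K]
    (a : H →L[ℂ] L) : HilbertTensor H K →L[ℂ] HilbertTensor L K :=
  (a.rTensor K).completion

end HilbertTensor

/-! ### Von Neumann algebras: type III factors, standard form, automorphisms, endomorphisms -/

namespace VonNeumannAlgebra

variable {H : Type v} [NormedAddCommGroup H] [InnerProductSpace ℂ H] [CompleteSpace H]

/-- The elements of `M`, as a star algebra. -/
abbrev Elem (M : VonNeumannAlgebra H) : Type v := M.toStarSubalgebra

/-- `M` is a factor: it is nonzero and its center consists of the scalars. -/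
def IsFactor (M : VonNeumannAlgebra H) : Prop :=
  Nontrivial H ∧ ∀ z : H →L[ℂ] H, z ∈ M → z ∈ M.commutant → ∃ c : ℂ, z = c • 1

/-- `M` is of type III: every nonzero projection of `M` is infinite, i.e. Murray-von Neumann
equivalent in `M` to a proper subprojection. -/
def IsTypeIII (M : VonNeumannAlgebra H) : Prop :=
  ∀ p : H →L[ℂ] H, p ∈ M → IsStarProjection p → p ≠ 0 →
    ∃ x : H →L[ℂ] H, x ∈ M ∧ star x * x = p ∧ x * star x ≤ p ∧ x * star x ≠ p

/-- The operator `J a J` for a conjugate-linear isometry `J`. -/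
def conjBy (J : H ≃ₗᵢ⋆[ℂ] H) (a : H →L[ℂ] H) : H →L[ℂ] H :=
  (J.toContinuousLinearEquiv.toContinuousLinearMap.comp a).comp
    J.toContinuousLinearEquiv.toContinuousLinearMap

/-- `M` acts on `H` in standard form `(M, H, J, P)` (Haagerup): `H` is `L²(M)`, `J` is the modular
conjugation and `P` is the self-dual positive cone. -/
structure StandardForm (M : VonNeumannAlgebra H) where
  J : H ≃ₗᵢ⋆[ℂ] H
  P : Set H
  J_J : ∀ ξ, J (J ξ) = ξ
  selfDual : ∀ η, η ∈ P ↔ ∀ ξ ∈ P, 0 ≤ (⟪ξ, η⟫_ℂ).re ∧ (⟪ξ, η⟫_ℂ).im = 0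
  conj_mem_iff : ∀ a : H →L[ℂ] H, conjBy J a ∈ M.commutant ↔ a ∈ M
  conj_center : ∀ z : H →L[ℂ] H, z ∈ M → z ∈ M.commutant → conjBy J z = star z
  J_cone : ∀ ξ ∈ P, J ξ = ξ
  cone_stable : ∀ a : H →L[ℂ] H, a ∈ M → ∀ ξ ∈ P, a (J (a (J ξ))) ∈ P

/-- The right action of `M` on `L²(M)`: `ξ · n = J n* J ξ`. -/
def StandardForm.rightMul {M : VonNeumannAlgebra H} (S : StandardForm M) (n : H →L[ℂ] H) :
    H →L[ℂ] H :=
  conjBy S.J (star n)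

/-- A unitary right `M`-modular map `L²(M) ⊗ K → L²(M)`, where the right action on `L²(M) ⊗ K` is
`(ξ ⊗ f) · n = (ξ · n) ⊗ f`. -/
structure RightModularUnitary {M : VonNeumannAlgebra H} (S : StandardForm M)
    (K : Type w) [NormedAddCommGroup K] [InnerProductSpace ℂ K] where
  toEquiv : HilbertTensor H K ≃ₗᵢ[ℂ] H
  modular : ∀ n : H →L[ℂ] H, n ∈ M → ∀ ζ : HilbertTensor H K,
    toEquiv (HilbertTensor.rmap K (S.rightMul n) ζ) = S.rightMul n (toEquiv ζ)

/-- `U` as a bounded operator. -/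
def RightModularUnitary.op {M : VonNeumannAlgebra H} {S : StandardForm M}
    {K : Type w} [NormedAddCommGroup K] [InnerProductSpace ℂ K] (U : RightModularUnitary S K) :
    HilbertTensor H K →L[ℂ] H :=
  U.toEquiv.toContinuousLinearEquiv.toContinuousLinearMap

/-- `U* = U⁻¹` as a bounded operator. -/
def RightModularUnitary.opAdj {M : VonNeumannAlgebra H} {S : StandardForm M}
    {K : Type w} [NormedAddCommGroup K] [InnerProductSpace ℂ K] (U : RightModularUnitary S K) :
    H →L[ℂ] HilbertTensor H K :=
  U.toEquiv.symm.toContinuousLinearEquiv.toContinuousLinearMap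

/-- The group of `*`-automorphisms of `M`. -/
abbrev Aut (M : VonNeumannAlgebra H) : Type v := M.Elem ≃⋆ₐ[ℂ] M.Elem

/-- The predual `M_*`: the functionals `m ↦ ∑ₙ ⟪ηₙ, m ξₙ⟫` with `∑ ‖ξₙ‖² < ∞`, `∑ ‖ηₙ‖² < ∞`. -/
def predual (M : VonNeumannAlgebra H) : Set (M.Elem → ℂ) :=
  {φ | ∃ ξ η : ℕ → H, Summable (fun n => ‖ξ n‖ ^ 2) ∧ Summable (fun n => ‖η n‖ ^ 2) ∧
    ∀ m : M.Elem, φ m = ∑' n, ⟪η n, (m : H →L[ℂ] H) (ξ n)⟫_ℂ}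

/-- The `u`-topology on `Aut(M)`: `α ↦ φ ∘ α` is norm continuous (i.e. uniformly on the unit ball
of `M`) for every `φ` in the predual. -/
@[reducible] def uTopology (M : VonNeumannAlgebra H) : TopologicalSpace M.Aut :=
  TopologicalSpace.induced
    (fun (a : M.Aut) (φ : M.predual) =>
      UniformFun.ofFun (fun m : {m : M.Elem // ‖m‖ ≤ 1} => φ.1 (a m.1)))
    inferInstance

/-- `α : G → Aut(M)` is Borel, for the Borel structure of the `u`-topology. -/
def IsBorelMap {G : Type u} [MeasurableSpace G] (M : VonNeumannAlgebra H) (α : G → M.Aut) : Prop :=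
  @Measurable G M.Aut _ (@borel M.Aut M.uTopology) α

/-- The inner automorphisms `Ad v`, for `v` a unitary of `M`. -/
def Inn (M : VonNeumannAlgebra H) : Subgroup M.Aut :=
  (Unitary.conjStarAlgAut ℂ M.Elem).range

instance innNormal (M : VonNeumannAlgebra H) : M.Inn.Normal := by
  constructor
  rintro _ ⟨v, rfl⟩ a
  refine ⟨⟨a v, ?_⟩, ?_⟩
  · rw [Unitary.mem_iff, ← map_star, ← map_mul, ← map_mul]
    simp
  · ext m
    simp only [Unitary.conjStarAlgAut_apply, StarAlgEquiv.mul_apply, StarAlgEquiv.aut_inv, map_mul,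
      StarAlgEquiv.apply_symm_apply, map_star]

/-- `Out(M) = Aut(M) / Inn(M)`. -/
abbrev Out (M : VonNeumannAlgebra H) : Type v := M.Aut ⧸ M.Inn

/-- A `*`-homomorphism `ρ : M → M` is normal: it preserves suprema of bounded upward directed
families of self-adjoint elements. -/
def IsNormalHom {M : VonNeumannAlgebra H} (ρ : M.Elem →⋆ₐ[ℂ] M.Elem) : Prop :=
  ∀ (D : Set M.Elem) (m : M.Elem), D.Nonempty → (∀ x ∈ D, IsSelfAdjoint x) →
    DirectedOn (fun x y : M.Elem => (x : H →L[ℂ] H) ≤ y) D →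
    ((∀ x ∈ D, (x : H →L[ℂ] H) ≤ m) ∧
      ∀ n : M.Elem, (∀ x ∈ D, (x : H →L[ℂ] H) ≤ n) → (m : H →L[ℂ] H) ≤ n) →
    ((∀ x ∈ D, (ρ x : H →L[ℂ] H) ≤ ρ m) ∧
      ∀ n : M.Elem, (∀ x ∈ D, (ρ x : H →L[ℂ] H) ≤ n) → (ρ m : H →L[ℂ] H) ≤ n)

/-- The objects of `End(M)`: normal unital `*`-endomorphisms of `M`. -/
structure NormalEnd (M : VonNeumannAlgebra H) where
  toHom : M.Elem →⋆ₐ[ℂ] M.Elem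
  normal : IsNormalHom toHom

/-- The intertwiners `(ρ, σ) = {T ∈ M | T ρ(m) = σ(m) T for all m ∈ M}`. -/
def intertwiners {M : VonNeumannAlgebra H} (ρ σ : M.NormalEnd) : Submodule ℂ M.Elem where
  carrier := {T | ∀ m, T * ρ.toHom m = σ.toHom m * T}
  add_mem' := by
    intro a b ha hb m
    rw [add_mul, mul_add, ha m, hb m]
  zero_mem' := by intro m; simp
  smul_mem' := by
    intro c a ha m
    rw [smul_mul_assoc, mul_smul_comm, ha m]

/-- The category `End(M)`. -/
instance (M : VonNeumannAlgebra H) : Category M.NormalEnd where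
  Hom ρ σ := intertwiners ρ σ
  id ρ := ⟨1, fun m => by simp⟩
  comp {ρ σ τ} s t := ⟨t.1 * s.1, fun m => by
    rw [mul_assoc, s.2 m, ← mul_assoc, t.2 m, mul_assoc]⟩
  id_comp s := Subtype.ext (mul_one s.1)
  comp_id s := Subtype.ext (one_mul s.1)
  assoc r s t := Subtype.ext (mul_assoc t.1 s.1 r.1).symm

/-- The element of `M` underlying a morphism of `End(M)`. -/
def NormalEnd.elem {M : VonNeumannAlgebra H} {ρ σ : M.NormalEnd} (T : ρ ⟶ σ) : M.Elem :=
  Subtype.val (p := fun x => x ∈ intertwiners ρ σ) T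

instance (M : VonNeumannAlgebra H) : Preadditive M.NormalEnd where
  homGroup ρ σ := inferInstanceAs (AddCommGroup (intertwiners ρ σ))
  add_comp _ _ _ _ _ _ := Subtype.ext (mul_add _ _ _)
  comp_add _ _ _ _ _ _ := Subtype.ext (add_mul _ _ _)

instance (M : VonNeumannAlgebra H) : Linear ℂ M.NormalEnd where
  homModule ρ σ := inferInstanceAs (Module ℂ (intertwiners ρ σ))
  smul_comp _ _ _ _ _ _ := Subtype.ext (mul_smul_comm _ _ _)
  comp_smul _ _ _ _ _ _ := Subtype.ext (smul_mul_assoc _ _ _)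

/-- The involution `T ↦ T*` from `(ρ, σ)` to `(σ, ρ)`. -/
def NormalEnd.dagger {M : VonNeumannAlgebra H} {ρ σ : M.NormalEnd} (T : ρ ⟶ σ) : σ ⟶ ρ :=
  (⟨star (NormalEnd.elem T), fun m => by
    have h := congrArg star (T.2 (star m))
    simpa [NormalEnd.elem, ← map_star] using h.symm⟩ : intertwiners σ ρ)

end VonNeumannAlgebra

open VonNeumannAlgebra

/-! ### Concrete `C(G)`-modules -/

section ConcreteModules

variable (G : Type u) [TopologicalSpace G] [MeasurableSpace G]

/-- A triple `(X, μ, g)`: a topological space with a nonzero finite Borel measure such that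
`L²(X, μ)` is separable, and a Borel map `g : X → G`. -/
structure ConcreteModule where
  X : Type u
  [topology : TopologicalSpace X]
  [measurableSpace : MeasurableSpace X]
  [borelSpace : BorelSpace X]
  μ : Measure X
  [finite : IsFiniteMeasure μ]
  ne_zero : μ ≠ 0
  g : X → G
  measurable_g : Measurable g
  separable : TopologicalSpace.SeparableSpace (Lp ℂ 2 μ)

attribute [instance] ConcreteModule.topology ConcreteModule.measurableSpace
  ConcreteModule.borelSpace ConcreteModule.finite

namespace ConcreteModule

variable {G}

/-- The Hilbert space `L²X`. -/
abbrev L2 (X : ConcreteModule G) : Type u := Lp ℂ 2 X.μ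

variable [CompactSpace G] [BorelSpace G]

lemma memLp_comp (X : ConcreteModule G) (f : C(G, ℂ)) : MemLp (fun x => f (X.g x)) ∞ X.μ :=
  memLp_top_of_bound ((f.continuous.measurable.comp X.measurable_g).aestronglyMeasurable) ‖f‖
    (Filter.Eventually.of_forall fun x => f.norm_coe_le_norm (X.g x))

/-- The action of `C(G)` on `L²X`: `f · ξ = M_{f ∘ g} ξ`, with `(M_{f ∘ g} ξ)(x) = f(g(x)) ξ(x)`. -/
def act (X : ConcreteModule G) (f : C(G, ℂ)) : X.L2 →L[ℂ] X.L2 :=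
  (ContinuousLinearMap.mul ℂ ℂ).holderL X.μ ∞ 2 2 (X.memLp_comp f).toLp

lemma act_coeFn (X : ConcreteModule G) (f : C(G, ℂ)) (ξ : X.L2) :
    X.act f ξ =ᵐ[X.μ] fun x => f (X.g x) * ξ x := by
  have h1 := (ContinuousLinearMap.mul ℂ ℂ).coeFn_holder (r := 2) (X.memLp_comp f).toLp ξ
  filter_upwards [h1, (X.memLp_comp f).coeFn_toLp] with x hx1 hx2
  simp only [act, ContinuousLinearMap.holderL_apply_apply]
  rw [hx1, hx2]
  rfl

lemma adjoint_act (X : ConcreteModule G) (f : C(G, ℂ)) :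
    ContinuousLinearMap.adjoint (X.act f) = X.act (star f) := by
  symm
  rw [ContinuousLinearMap.eq_adjoint_iff]
  intro ξ η
  rw [L2.inner_def, L2.inner_def]
  refine integral_congr_ae ?_
  filter_upwards [X.act_coeFn (star f) ξ, X.act_coeFn f η] with x h1 h2
  rw [h1, h2]
  simp [mul_comm, mul_assoc]

/-- The bounded `C(G)`-equivariant linear maps `L²X → L²Y`. -/
def equivariantMaps (X Y : ConcreteModule G) : Submodule ℂ (X.L2 →L[ℂ] Y.L2) where
  carrier := {t | ∀ f : C(G, ℂ), t ∘L X.act f = Y.act f ∘L t}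
  add_mem' := by
    intro a b ha hb f
    rw [ContinuousLinearMap.add_comp, ContinuousLinearMap.comp_add, ha f, hb f]
  zero_mem' := by intro f; simp
  smul_mem' := by
    intro c a ha f
    rw [ContinuousLinearMap.smul_comp, ContinuousLinearMap.comp_smul, ha f]

/-- The category of concrete `C(G)`-modules. -/
instance : Category (ConcreteModule G) where
  Hom X Y := equivariantMaps X Y
  id X := ⟨ContinuousLinearMap.id ℂ X.L2, fun f => by simp⟩
  comp s t := ⟨t.1 ∘L s.1, fun f => by
    rw [ContinuousLinearMap.comp_assoc, s.2 f, ← ContinuousLinearMap.comp_assoc, t.2 f,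
      ContinuousLinearMap.comp_assoc]⟩
  id_comp _ := Subtype.ext (ContinuousLinearMap.comp_id _)
  comp_id _ := Subtype.ext (ContinuousLinearMap.id_comp _)
  assoc r s t := Subtype.ext (ContinuousLinearMap.comp_assoc t.1 s.1 r.1).symm

/-- The bounded operator underlying a morphism. -/
def op {X Y : ConcreteModule G} (t : X ⟶ Y) : X.L2 →L[ℂ] Y.L2 :=
  Subtype.val (p := fun x => x ∈ equivariantMaps X Y) t

instance : Preadditive (ConcreteModule G) where
  homGroup X Y := inferInstanceAs (AddCommGroup (equivariantMaps X Y))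
  add_comp _ _ _ _ _ _ := Subtype.ext (ContinuousLinearMap.comp_add _ _ _)
  comp_add _ _ _ _ _ _ := Subtype.ext (ContinuousLinearMap.add_comp _ _ _)

instance : Linear ℂ (ConcreteModule G) where
  homModule X Y := inferInstanceAs (Module ℂ (equivariantMaps X Y))
  smul_comp _ _ _ _ _ _ := Subtype.ext (ContinuousLinearMap.comp_smul _ _ _)
  comp_smul _ _ _ _ _ _ := Subtype.ext (ContinuousLinearMap.smul_comp _ _ _)

/-- The involution `t ↦ t*` on morphisms. -/
def dagger {X Y : ConcreteModule G} (t : X ⟶ Y) : Y ⟶ X :=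
  (⟨ContinuousLinearMap.adjoint (op t), fun f => by
    have h := congrArg ContinuousLinearMap.adjoint (t.2 (star f))
    rw [ContinuousLinearMap.adjoint_comp, ContinuousLinearMap.adjoint_comp, adjoint_act,
      adjoint_act, star_star] at h
    exact h.symm⟩ : equivariantMaps Y X)

variable [SecondCountableTopology G]

/-- The triple `(G, μ_E, id)` with `μ_E(A) = μ(A ∩ E)`, for a Borel set `E` with `μ(E) > 0`. -/
def ofSubset (μ : Measure G) [IsFiniteMeasure μ] (E : Set G) (hE : μ E ≠ 0) :
    ConcreteModule G where
  X := G
  μ := μ.restrict E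
  ne_zero := by rwa [Ne, Measure.restrict_eq_zero]
  g := id
  measurable_g := measurable_id
  separable := by
    have : Fact ((2 : ℝ≥0∞) ≠ ∞) := ⟨by simp⟩
    infer_instance

end ConcreteModule

end ConcreteModules

/-! ### `G`-kernels and the direct integrals `σ_X` -/

section GKernels

variable (G : Type u) [Group G] [MeasurableSpace G]
variable {H : Type v} [NormedAddCommGroup H] [InnerProductSpace ℂ H] [CompleteSpace H]

/-- A `G`-kernel on `M`: an injective homomorphism `θ : G → Out(M)` which admits a Borel lift
`G → Aut(M)`. -/
structure GKernel (M : VonNeumannAlgebra H) where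
  toHom : G →* M.Out
  injective : Function.Injective toHom
  exists_lift : ∃ α : G → M.Aut, M.IsBorelMap α ∧ ∀ g, QuotientGroup.mk (α g) = toHom g

variable {G}

/-- A Borel lift `α : G → Aut(M)` of a `G`-kernel `θ`. -/
structure BorelLift {M : VonNeumannAlgebra H} (θ : GKernel G M) where
  toFun : G → M.Aut
  borel : M.IsBorelMap toFun
  lift : ∀ g, QuotientGroup.mk (toFun g) = θ.toHom g

/-- Weak measurability of `g ↦ α_g(m)` for a Borel map `α`. -/
lemma VonNeumannAlgebra.IsBorelMap.measurable_inner {M : VonNeumannAlgebra H} {α : G → M.Aut}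
    (hα : M.IsBorelMap α) (m : M.Elem) (ξ η : H) :
    Measurable fun g => ⟪η, (α g m : H →L[ℂ] H) ξ⟫_ℂ := by
  let _ : TopologicalSpace M.Aut := M.uTopology
  let _ : MeasurableSpace M.Aut := borel M.Aut
  have : BorelSpace M.Aut := ⟨rfl⟩
  have hα' : Measurable α := hα
  let c : ℝ := ‖m‖ + 1
  have hc : 0 < c := by positivity
  let m' : {m : M.Elem // ‖m‖ ≤ 1} := ⟨((c⁻¹ : ℝ) : ℂ) • m, by
    rw [norm_smul, Complex.norm_real, Real.norm_of_nonneg (by positivity), inv_mul_le_iff₀ hc]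
    simp [c]⟩
  let φ : M.predual := ⟨fun m => ⟪η, (m : H →L[ℂ] H) ξ⟫_ℂ, Pi.single 0 ξ, Pi.single 0 η,
    summable_of_ne_finset_zero (s := {0}) (fun n hn => by
      rw [Pi.single_eq_of_ne (by simpa using hn)]; simp),
    summable_of_ne_finset_zero (s := {0}) (fun n hn => by
      rw [Pi.single_eq_of_ne (by simpa using hn)]; simp),
    fun m => by
      rw [tsum_eq_single 0 (fun n hn => by rw [Pi.single_eq_of_ne hn]; simp)]
      simp⟩
  have h1 : Continuous fun a : M.Aut => UniformFun.ofFun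
      (fun m : {m : M.Elem // ‖m‖ ≤ 1} => φ.1 (a m.1)) :=
    (continuous_apply φ).comp (continuous_induced_dom (f := fun (a : M.Aut) (φ : M.predual) =>
      UniformFun.ofFun (fun m : {m : M.Elem // ‖m‖ ≤ 1} => φ.1 (a m.1))))
  have h2 : Continuous fun a : M.Aut => φ.1 (a m'.1) :=
    (UniformFun.uniformContinuous_eval (β := ℂ) m').continuous.comp h1
  have h3 : Measurable fun g => (c : ℂ) * φ.1 (α g m'.1) :=
    (h2.measurable.comp hα').const_mul _
  convert h3 using 2 with g
  have hc' : (c : ℂ) ≠ 0 := by exact_mod_cast hc.ne'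
  simp [φ, m', hc']

lemma VonNeumannAlgebra.norm_aut_le {M : VonNeumannAlgebra H} (a : M.Aut) (m : M.Elem) :
    ‖(a m : H →L[ℂ] H)‖ ≤ ‖m‖ := by
  have : IsClosed (M.toStarSubalgebra : Set (H →L[ℂ] H)) := by
    have h : (M.toStarSubalgebra : Set (H →L[ℂ] H)) =
        Set.centralizer (Set.centralizer (M : Set (H →L[ℂ] H))) :=
      M.centralizer_centralizer.symm
    rw [h]
    exact Set.isClosed_centralizer _
  exact NonUnitalStarAlgHom.norm_apply_le (A := M.Elem) (B := M.Elem) a m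

section Decomposable

variable {X : Type w} [MeasurableSpace X] (μ : Measure X)

lemma pairwise_disjoint_ball {ι : Type*} {b : ι → H} (hb : Orthonormal ℂ b) :
    Pairwise (Function.onFun Disjoint fun i => Metric.ball (b i) (1 / 2)) := by
  intro i j hij
  refine Metric.ball_disjoint_ball ?_
  have h : ‖b i - b j‖ ^ 2 = 2 := by
    rw [@norm_sub_sq ℂ, hb.1 i, hb.1 j, hb.2 hij]
    norm_num
  rw [dist_eq_norm]
  nlinarith [norm_nonneg (b i - b j)]

lemma stronglyMeasurable_of_inner [TopologicalSpace.SeparableSpace H] {h : X → H}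
    (hh : ∀ η, Measurable fun x => ⟪η, h x⟫_ℂ) : StronglyMeasurable h := by
  obtain ⟨w, b, hb⟩ := exists_hilbertBasis ℂ H
  have : Countable w := by
    refine (pairwise_disjoint_ball b.orthonormal).countable_of_isOpen_disjoint
      (fun i => Metric.isOpen_ball) (fun i => ⟨b i, Metric.mem_ball_self (by norm_num)⟩)
  have hs : ∀ x, Filter.Tendsto (fun s : Finset w => ∑ i ∈ s, ⟪b i, h x⟫_ℂ • b i) Filter.atTop
      (nhds (h x)) := fun x => by
    have := b.hasSum_repr (h x)
    simpa [HasSum, b.repr_apply_apply] using this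
  refine stronglyMeasurable_of_tendsto Filter.atTop (fun s => ?_) (tendsto_pi_nhds.2 hs)
  exact Finset.stronglyMeasurable_fun_sum s fun i _ => (hh _).stronglyMeasurable.smul_const _

lemma aestronglyMeasurable_field [TopologicalSpace.SeparableSpace H] {a : X → H →L[ℂ] H}
    (ha : ∀ ξ η, Measurable fun x => ⟪η, a x ξ⟫_ℂ) {F : X → H} (hF : AEStronglyMeasurable F μ) :
    AEStronglyMeasurable (fun x => a x (F x)) μ := by
  borelize H
  have h1 : StronglyMeasurable (Function.uncurry fun (ξ : H) (x : X) => a x ξ) := by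
    have : SecondCountableTopology H := UniformSpace.secondCountable_of_separable H
    exact stronglyMeasurable_uncurry_of_continuous_of_stronglyMeasurable
      (fun x => (a x).continuous) (fun ξ => stronglyMeasurable_of_inner (ha ξ))
  obtain ⟨F', hF', hFF'⟩ := hF
  refine ⟨fun x => a x (F' x), ?_, hFF'.mono fun x hx => by simp [hx]⟩
  exact h1.comp_measurable (hF'.measurable.prodMk measurable_id)

/-- The decomposable operator `(a F)(x) = a(x) F(x)` on `L²(X, H)`, for a bounded weakly measurable
field `a` of operators. -/
def decomposable [TopologicalSpace.SeparableSpace H] (a : X → H →L[ℂ] H)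
    (ha : ∀ ξ η, Measurable fun x => ⟪η, a x ξ⟫_ℂ) (C : ℝ) (hC : ∀ x, ‖a x‖ ≤ C) :
    Lp H 2 μ →L[ℂ] Lp H 2 μ :=
  have hle : ∀ (F : Lp H 2 μ) x, ‖a x (F x)‖ ≤ C * ‖F x‖ := fun F x =>
    (a x).le_of_opNorm_le (hC x) _
  have hmem : ∀ F : Lp H 2 μ, MemLp (fun x => a x (F x)) 2 μ := fun F =>
    (Lp.memLp F).of_le_mul (aestronglyMeasurable_field μ ha (Lp.memLp F).1)
      (Filter.Eventually.of_forall (hle F))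
  LinearMap.mkContinuous
    { toFun := fun F => (hmem F).toLp
      map_add' := fun F F' => by
        apply Lp.ext
        filter_upwards [(hmem (F + F')).coeFn_toLp, (hmem F).coeFn_toLp, (hmem F').coeFn_toLp,
          Lp.coeFn_add F F', Lp.coeFn_add (hmem F).toLp (hmem F').toLp] with x h1 h2 h3 h4 h5
        rw [h1, h5, h4]
        simp [h2, h3]
      map_smul' := fun c F => by
        apply Lp.ext
        filter_upwards [(hmem (c • F)).coeFn_toLp, (hmem F).coeFn_toLp,
          Lp.coeFn_smul c F, Lp.coeFn_smul c (hmem F).toLp] with x h1 h2 h4 h5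
        simp only [RingHom.id_apply]
        rw [h1, h5, h4]
        simp [h2] }
    C (fun F => Lp.norm_le_mul_norm_of_ae_le_mul (by
      filter_upwards [(hmem F).coeFn_toLp] with x hx
      simp only [LinearMap.coe_mk, AddHom.coe_mk]
      rw [hx]
      exact hle F x))

lemma decomposable_coeFn [TopologicalSpace.SeparableSpace H] (a : X → H →L[ℂ] H)
    (ha : ∀ ξ η, Measurable fun x => ⟪η, a x ξ⟫_ℂ) (C : ℝ) (hC : ∀ x, ‖a x‖ ≤ C)
    (F : Lp H 2 μ) : decomposable μ a ha C hC F =ᵐ[μ] fun x => a x (F x) := by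
  simp only [decomposable, LinearMap.mkContinuous_apply, LinearMap.coe_mk, AddHom.coe_mk]
  exact MemLp.coeFn_toLp _

/-- The bilinear map `(ξ, f) ↦ (x ↦ f(x) ξ)`. -/
def tensorToLpAux : H →ₗ[ℂ] Lp ℂ 2 μ →ₗ[ℂ] Lp H 2 μ :=
  LinearMap.mk₂ ℂ (fun ξ f => (ContinuousLinearMap.toSpanSingleton ℂ ξ).compLp f)
    (fun ξ ξ' f => by
      apply Lp.ext
      filter_upwards [ContinuousLinearMap.coeFn_compLp (.toSpanSingleton ℂ (ξ + ξ')) f,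
        ContinuousLinearMap.coeFn_compLp (.toSpanSingleton ℂ ξ) f,
        ContinuousLinearMap.coeFn_compLp (.toSpanSingleton ℂ ξ') f,
        Lp.coeFn_add ((ContinuousLinearMap.toSpanSingleton ℂ ξ).compLp f)
          ((ContinuousLinearMap.toSpanSingleton ℂ ξ').compLp f)] with x h1 h2 h3 h4
      rw [h1, h4]
      simp [h2, h3])
    (fun c ξ f => by
      apply Lp.ext
      filter_upwards [ContinuousLinearMap.coeFn_compLp (.toSpanSingleton ℂ (c • ξ)) f,
        ContinuousLinearMap.coeFn_compLp (.toSpanSingleton ℂ ξ) f,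
        Lp.coeFn_smul c ((ContinuousLinearMap.toSpanSingleton ℂ ξ).compLp f)] with x h1 h2 h4
      rw [h1, h4]
      simp [h2, smul_comm c])
    (fun ξ f f' => ContinuousLinearMap.map_add (ContinuousLinearMap.compLpL 2 μ _) f f')
    (fun c ξ f => ContinuousLinearMap.map_smul (ContinuousLinearMap.compLpL 2 μ _) c f)

lemma tensorToLpAux_coeFn (ξ : H) (f : Lp ℂ 2 μ) :
    tensorToLpAux μ ξ f =ᵐ[μ] fun x => f x • ξ := by
  have h : tensorToLpAux μ ξ f = (ContinuousLinearMap.toSpanSingleton ℂ ξ).compLp f := rfl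
  rw [h]
  filter_upwards [ContinuousLinearMap.coeFn_compLp (.toSpanSingleton ℂ ξ) f] with x hx
  simpa using hx

lemma inner_tensorToLpAux (z w : H ⊗[ℂ] Lp ℂ 2 μ) :
    ⟪TensorProduct.lift (tensorToLpAux μ) z, TensorProduct.lift (tensorToLpAux μ) w⟫_ℂ =
      ⟪z, w⟫_ℂ := by
  induction z with
  | zero => simp
  | add z z' hz hz' => simp [inner_add_left, hz, hz']
  | tmul ξ f =>
    induction w with
    | zero => simp
    | add w w' hw hw' => simp only [map_add, inner_add_right, hw, hw']
    | tmul η h =>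
      rw [TensorProduct.lift.tmul, TensorProduct.lift.tmul, TensorProduct.inner_tmul, L2.inner_def,
        L2.inner_def, ← integral_const_mul]
      refine integral_congr_ae ?_
      filter_upwards [tensorToLpAux_coeFn μ ξ f, tensorToLpAux_coeFn μ η h] with x h1 h2
      rw [h1, h2]
      simp [inner_smul_left, inner_smul_right]
      ring

/-- The canonical isometry `H ⊗ L²(X) → L²(X, H)`, `ξ ⊗ f ↦ (x ↦ f(x) ξ)`. -/
def tensorToLp : HilbertTensor H (Lp ℂ 2 μ) →L[ℂ] Lp H 2 μ :=
  ((TensorProduct.lift (tensorToLpAux (H := H) μ)).isometryOfInner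
    (inner_tensorToLpAux μ)).toContinuousLinearMap.fromCompletion

lemma tensorToLp_tmul (ξ : H) (f : Lp ℂ 2 μ) :
    tensorToLp μ (HilbertTensor.tmul ξ f) =ᵐ[μ] fun x => f x • ξ := by
  have : tensorToLp μ (HilbertTensor.tmul ξ f) = tensorToLpAux μ ξ f := by
    simp [tensorToLp, HilbertTensor.tmul]
  rw [this]
  exact tensorToLpAux_coeFn μ ξ f

end Decomposable

variable [TopologicalSpace G]

/-- The direct integral `σ_X(m) = ∫_X α_{g(x)}(m) ⊗ dE_X(x)`: the operator on `L²(M) ⊗ L²X` which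
corresponds to `F ↦ (x ↦ α_{g(x)}(m) F(x))` under the canonical identification of `L²(M) ⊗ L²X`
with `L²(X, L²(M))`. -/
def sigmaOp [TopologicalSpace.SeparableSpace H] {M : VonNeumannAlgebra H} {θ : GKernel G M}
    (α : BorelLift θ) (X : ConcreteModule G) (m : M.Elem) :
    HilbertTensor H X.L2 →L[ℂ] HilbertTensor H X.L2 :=
  ContinuousLinearMap.adjoint (tensorToLp X.μ) ∘L
    decomposable X.μ (fun x => (α.toFun (X.g x) m : H →L[ℂ] H))
      (fun ξ η => (α.borel.measurable_inner m ξ η).comp X.measurable_g) ‖m‖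
      (fun x => norm_aut_le (α.toFun (X.g x)) m) ∘L
    tensorToLp X.μ

/-- The defining weak formula of `σ_X(m) = ∫_X α_{g(x)}(m) ⊗ dE_X(x)`. -/
lemma inner_sigmaOp [TopologicalSpace.SeparableSpace H] {M : VonNeumannAlgebra H}
    {θ : GKernel G M} (α : BorelLift θ) (X : ConcreteModule G) (m : M.Elem) (ξ η : H)
    (f h : X.L2) :
    ⟪HilbertTensor.tmul η h, sigmaOp α X m (HilbertTensor.tmul ξ f)⟫_ℂ =
      ∫ x, ⟪η, (α.toFun (X.g x) m : H →L[ℂ] H) ξ⟫_ℂ * (star (h x) * f x) ∂X.μ := by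
  simp only [sigmaOp, ContinuousLinearMap.comp_apply]
  rw [ContinuousLinearMap.adjoint_inner_right, L2.inner_def]
  refine integral_congr_ae ?_
  filter_upwards [tensorToLp_tmul X.μ ξ f, tensorToLp_tmul X.μ η h,
    decomposable_coeFn X.μ (fun x => (α.toFun (X.g x) m : H →L[ℂ] H))
      (fun ξ η => (α.borel.measurable_inner m ξ η).comp X.measurable_g) ‖m‖
      (fun x => norm_aut_le (α.toFun (X.g x)) m)
      (tensorToLp X.μ (HilbertTensor.tmul ξ f))] with x h1 h2 h3
  rw [h2, h3, h1]
  simp [inner_smul_left, inner_smul_right]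
  ring

/-- `ρ_X(m) = U_X σ_X(m) U_X*`. -/
def rhoOp [TopologicalSpace.SeparableSpace H] {M : VonNeumannAlgebra H} {S : StandardForm M}
    {θ : GKernel G M} (α : BorelLift θ) (X : ConcreteModule G) (U : RightModularUnitary S X.L2)
    (m : M.Elem) : H →L[ℂ] H :=
  U.op ∘L sigmaOp α X m ∘L U.opAdj

variable [CompactSpace G] [BorelSpace G] [SecondCountableTopology G]

/-- For every finite Borel measure `μ` on `G` and all proper Borel sets `E`, `F` with
`μ(E ∩ F) = 0`: `(ρ_{μ_E}, ρ_{μ_F}) = 0`, for every choice of the unitaries `U_{μ_E}`, `U_{μ_F}`. -/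
def HasDisjointIntegrals [TopologicalSpace.SeparableSpace H] {M : VonNeumannAlgebra H}
    (S : StandardForm M) {θ : GKernel G M} (α : BorelLift θ) : Prop :=
  ∀ (μ : Measure G) [IsFiniteMeasure μ] (E F : Set G), MeasurableSet E → MeasurableSet F →
    ∀ (hE : μ E ≠ 0) (_ : μ Eᶜ ≠ 0) (hF : μ F ≠ 0) (_ : μ Fᶜ ≠ 0), μ (E ∩ F) = 0 →
    ∀ (UE : RightModularUnitary S (ConcreteModule.ofSubset μ E hE).L2)
      (UF : RightModularUnitary S (ConcreteModule.ofSubset μ F hF).L2) (T : M.Elem),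
      (∀ m : M.Elem, (T : H →L[ℂ] H) * rhoOp α _ UE m = rhoOp α _ UF m * (T : H →L[ℂ] H)) →
      T = 0

/-- The `G`-kernel `θ` is minimal: some Borel lift of `θ` has disjoint integrals over disjoint
proper Borel sets. -/
def GKernel.IsMinimal [TopologicalSpace.SeparableSpace H] {M : VonNeumannAlgebra H}
    (S : StandardForm M) (θ : GKernel G M) : Prop :=
  ∃ α : BorelLift θ, HasDisjointIntegrals S α

end GKernels

end

open VonNeumannAlgebra

/-! Since `J` exchanges `M` and its commutant `M'`, a right `M`-modular map is one commuting with
the action of `M'`. So `L²(M) ⊗ K` and `L²(M)` are compared as `M'`-modules, by a Cantor–Bernstein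
argument (`exists_unitary_of_isometries`) that needs an equivariant isometry in each direction. One
is `ξ ↦ ξ ⊗ g` for a unit vector `g`. The other is the polar part of an injective equivariant
operator. To build that operator, type III supplies an isometry `w ∈ M` with `p = 1 - w w* ≠ 0`. The
ranges of `wᵏ p` are mutually orthogonal, so countably many operators can be packed into a single
one. Factoriality and separability supply countably many `bₙ ∈ M` for which the `p bₙ` have no
common kernel.

Under `L²(M) ⊗ L²X ≅ L²(X, L²(M))` the operator `σ_X(m)` acts at `x` by `α_{g(x)}(m)`. Algebraic
identities and commutation with `M' ⊗ 1` are therefore checked pointwise, and conjugation by `U_X`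
gives a star homomorphism into `M`. For normality, separability reduces directed families to
increasing sequences, for which dominated convergence applies.

Functoriality rests on `1 ⊗ t` intertwining `σ_X` and `σ_Y`. In matrix coefficients this is
equivariance of `t` for the bounded Borel function `g ↦ ⟪η, α_g(m) ξ⟫`, and `C(G)`-equivariance
extends to such functions by `L¹`-approximation (`integral_comp_mul_eq_of_continuous`). Faithfulness
is injectivity of `t ↦ 1 ⊗ t`. If `F` is full, an intertwiner between integrals over `E` and `F`
comes from an equivariant `t`. Equivariance for the indicator of `E` then forces `t = 0`. -/

noncomputable section

/-! ### Operators on Hilbert space tensor products -/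

namespace HilbertTensor

variable {H K L N : Type*}
  [NormedAddCommGroup H] [InnerProductSpace ℂ H]
  [NormedAddCommGroup K] [InnerProductSpace ℂ K]
  [NormedAddCommGroup L] [InnerProductSpace ℂ L]
  [NormedAddCommGroup N] [InnerProductSpace ℂ N]

lemma inner_tmul (ξ η : H) (f h : K) :
    ⟪tmul ξ f, tmul η h⟫_ℂ = ⟪ξ, η⟫_ℂ * ⟪f, h⟫_ℂ := by
  simp [tmul]

lemma norm_tmul (ξ : H) (f : K) : ‖tmul ξ f‖ = ‖ξ‖ * ‖f‖ := by
  simp [tmul]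

@[simp]
lemma lmap_tmul (t : K →L[ℂ] L) (ξ : H) (f : K) : lmap H t (tmul ξ f) = tmul ξ (t f) := by
  simp [lmap, tmul]

@[simp]
lemma rmap_tmul (a : H →L[ℂ] L) (ξ : H) (f : K) : rmap K a (tmul ξ f) = tmul (a ξ) f := by
  simp [rmap, tmul]

/-- Bounded operators on a tensor product are determined by their values on elementary tensors. -/
lemma clm_ext {A B : HilbertTensor H K →L[ℂ] N}
    (h : ∀ ξ f, A (tmul ξ f) = B (tmul ξ f)) : A = B := by
  ext ζ
  induction ζ using UniformSpace.Completion.induction_on with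
  | hp => exact isClosed_eq A.continuous B.continuous
  | ih z =>
    induction z with
    | zero => rw [UniformSpace.Completion.coe_zero, map_zero, map_zero]
    | add z w hz hw => rw [UniformSpace.Completion.coe_add, map_add, map_add, hz, hw]
    | tmul ξ f => exact h ξ f

/-- Pairing with `ζ` is a bounded functional, hence determined by its values on elementary tensors.
-/
lemma eq_zero_of_inner_tmul {ζ : HilbertTensor H K}
    (h : ∀ ξ f, ⟪tmul ξ f, ζ⟫_ℂ = 0) : ζ = 0 := by
  have h0 : innerSL ℂ ζ = 0 := clm_ext fun ξ f => by
    rw [innerSL_apply_apply, ← inner_conj_symm, h ξ f]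
    simp
  simpa using congrArg (fun A => A ζ) h0

/-- Operators between tensor products are determined by their matrix coefficients on elementary
tensors. -/
lemma clm_ext_inner {A B : HilbertTensor H K →L[ℂ] HilbertTensor L N}
    (h : ∀ ξ f η k, ⟪tmul η k, A (tmul ξ f)⟫_ℂ = ⟪tmul η k, B (tmul ξ f)⟫_ℂ) : A = B :=
  clm_ext fun ξ f => by
    rw [← sub_eq_zero]
    refine eq_zero_of_inner_tmul fun η k => ?_
    rw [inner_sub_right, h, sub_self]

lemma lmap_id : lmap H (ContinuousLinearMap.id ℂ K) = ContinuousLinearMap.id ℂ _ :=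
  clm_ext fun ξ f => by simp

lemma lmap_comp (s : L →L[ℂ] N) (t : K →L[ℂ] L) : lmap H (s ∘L t) = lmap H s ∘L lmap H t :=
  clm_ext fun ξ f => by simp

lemma tmul_add (ξ : H) (f f' : K) : tmul ξ (f + f') = tmul ξ f + tmul ξ f' := by
  simp [tmul, TensorProduct.tmul_add, UniformSpace.Completion.coe_add]

lemma tmul_smul (c : ℂ) (ξ : H) (f : K) : tmul ξ (c • f) = c • tmul ξ f := by
  simp [tmul, UniformSpace.Completion.coe_smul]

lemma add_tmul (ξ ξ' : H) (f : K) : tmul (ξ + ξ') f = tmul ξ f + tmul ξ' f := by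
  simp [tmul, TensorProduct.add_tmul, UniformSpace.Completion.coe_add]

lemma smul_tmul (c : ℂ) (ξ : H) (f : K) : tmul (c • ξ) f = c • tmul ξ f := by
  rw [tmul, tmul, ← UniformSpace.Completion.coe_smul, TensorProduct.smul_tmul']

lemma lmap_add (s t : K →L[ℂ] L) : lmap H (s + t) = lmap H s + lmap H t :=
  clm_ext fun ξ f => by simp [tmul_add]

lemma lmap_smul (c : ℂ) (t : K →L[ℂ] L) : lmap H (c • t) = c • lmap H t :=
  clm_ext fun ξ f => by simp [tmul_smul]

lemma lmap_comp_rmap (t : K →L[ℂ] L) (a : H →L[ℂ] H) :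
    lmap H t ∘L rmap K a = rmap L a ∘L lmap H t :=
  clm_ext fun ξ f => by simp

lemma adjoint_lmap [CompleteSpace K] [CompleteSpace L] (t : K →L[ℂ] L) :
    ContinuousLinearMap.adjoint (lmap H t) = lmap H (ContinuousLinearMap.adjoint t) :=
  clm_ext_inner fun ξ f η k => by
    rw [ContinuousLinearMap.adjoint_inner_right, lmap_tmul, lmap_tmul, inner_tmul, inner_tmul,
      ContinuousLinearMap.adjoint_inner_right]

lemma adjoint_rmap [CompleteSpace H] [CompleteSpace L] (a : H →L[ℂ] L) :
    ContinuousLinearMap.adjoint (rmap K a) = rmap K (ContinuousLinearMap.adjoint a) :=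
  clm_ext_inner fun ξ f η k => by
    rw [ContinuousLinearMap.adjoint_inner_right, rmap_tmul, rmap_tmul, inner_tmul, inner_tmul,
      ContinuousLinearMap.adjoint_inner_right]

/-- The norm is a cross norm: `‖ξ ⊗ (s - t) f‖ = ‖ξ‖ ‖(s - t) f‖`, and some `ξ` is nonzero. This is
the source of faithfulness of `F`. -/
lemma lmap_injective [Nontrivial H] :
    Function.Injective (lmap H : (K →L[ℂ] L) → HilbertTensor H K →L[ℂ] HilbertTensor H L) := by
  intro s t hst
  ext f
  obtain ⟨ξ, hξ⟩ := exists_ne (0 : H)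
  have h : tmul ξ (s f - t f) = 0 := by
    rw [sub_eq_add_neg, ← neg_one_smul ℂ, tmul_add, tmul_smul, ← lmap_tmul, ← lmap_tmul, hst]
    simp
  have h' := norm_tmul ξ (s f - t f)
  rw [h, norm_zero, eq_comm, mul_eq_zero, norm_eq_zero, norm_eq_zero, sub_eq_zero] at h'
  exact h'.resolve_left hξ

/-- The operator `ξ ↦ ξ ⊗ f`. -/
def tmulRight (H : Type*) [NormedAddCommGroup H] [InnerProductSpace ℂ H] (f : K) :
    H →L[ℂ] HilbertTensor H K :=
  LinearMap.mkContinuous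
    { toFun := fun ξ => tmul ξ f
      map_add' := fun ξ ξ' => add_tmul ξ ξ' f
      map_smul' := fun c ξ => smul_tmul c ξ f } ‖f‖
    fun ξ => by
      rw [mul_comm]
      exact (norm_tmul ξ f).le

@[simp]
lemma tmulRight_apply (f : K) (ξ : H) : tmulRight H f ξ = tmul ξ f := rfl

lemma rmap_comp_tmulRight (a : H →L[ℂ] H) (f : K) :
    rmap K a ∘L tmulRight H f = tmulRight H f ∘L a := by
  ext ξ
  simp

end HilbertTensor

/-! ### The commutant and the right action -/

namespace VonNeumannAlgebra

variable {H : Type v} [NormedAddCommGroup H] [InnerProductSpace ℂ H] [CompleteSpace H]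
  {M : VonNeumannAlgebra H}

/-- `M` is its own bicommutant, so membership in `M` is tested against `M'`. -/
lemma mem_of_commutes {a : H →L[ℂ] H} (h : ∀ b ∈ M.commutant, b ∘L a = a ∘L b) : a ∈ M := by
  rw [← M.commutant_commutant, mem_commutant_iff]
  exact h

lemma commutes_of_mem {a b : H →L[ℂ] H} (ha : a ∈ M) (hb : b ∈ M.commutant) : b ∘L a = a ∘L b :=
  (mem_commutant_iff.1 hb a ha).symm

lemma StandardForm.conjBy_conjBy (S : StandardForm M) (a : H →L[ℂ] H) :
    conjBy S.J (conjBy S.J a) = a := by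
  ext ξ
  simp [conjBy, S.J_J]

lemma StandardForm.rightMul_mem (S : StandardForm M) {n : H →L[ℂ] H} (hn : n ∈ M) :
    S.rightMul n ∈ M.commutant :=
  (S.conj_mem_iff _).2 (star_mem hn)

/-- With `rightMul_mem`, this makes the right multiplications exhaust `M'`; from here on modularity
is expressed through `M'` alone. -/
lemma StandardForm.exists_rightMul (S : StandardForm M) {b : H →L[ℂ] H} (hb : b ∈ M.commutant) :
    ∃ n ∈ M, S.rightMul n = b := by
  refine ⟨star (conjBy S.J b), star_mem ((S.conj_mem_iff _).1 ?_), ?_⟩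
  · rwa [S.conjBy_conjBy]
  · rw [StandardForm.rightMul, star_star, S.conjBy_conjBy]

section RightModularUnitary

variable {S : StandardForm M} {K : Type w} [NormedAddCommGroup K] [InnerProductSpace ℂ K]
  (U : RightModularUnitary S K)

lemma RightModularUnitary.op_comp_rmap {b : H →L[ℂ] H} (hb : b ∈ M.commutant) :
    U.op ∘L HilbertTensor.rmap K b = b ∘L U.op := by
  obtain ⟨n, hn, rfl⟩ := S.exists_rightMul hb
  ext ζ
  exact U.modular n hn ζ

@[simp]
lemma RightModularUnitary.op_opAdj (ξ : H) : U.op (U.opAdj ξ) = ξ := by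
  simp [RightModularUnitary.op, RightModularUnitary.opAdj]

@[simp]
lemma RightModularUnitary.opAdj_op (ζ : HilbertTensor H K) : U.opAdj (U.op ζ) = ζ := by
  simp [RightModularUnitary.op, RightModularUnitary.opAdj]

lemma RightModularUnitary.rmap_comp_opAdj {b : H →L[ℂ] H} (hb : b ∈ M.commutant) :
    HilbertTensor.rmap K b ∘L U.opAdj = U.opAdj ∘L b := by
  ext ξ
  have h := congrArg (fun A => U.opAdj (A (U.opAdj ξ))) (U.op_comp_rmap hb)
  simpa using h

lemma RightModularUnitary.inner_op (ζ : HilbertTensor H K) (ξ : H) :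
    ⟪U.op ζ, ξ⟫_ℂ = ⟪ζ, U.opAdj ξ⟫_ℂ := by
  rw [← U.toEquiv.inner_map_map ζ]
  congr 1
  exact (U.op_opAdj ξ).symm

lemma RightModularUnitary.adjoint_op : ContinuousLinearMap.adjoint U.op = U.opAdj := by
  symm
  rw [ContinuousLinearMap.eq_adjoint_iff]
  intro ξ ζ
  rw [← inner_conj_symm, ← U.inner_op, inner_conj_symm]

lemma RightModularUnitary.adjoint_opAdj : ContinuousLinearMap.adjoint U.opAdj = U.op := by
  rw [← U.adjoint_op, ContinuousLinearMap.adjoint_adjoint]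

/-- An operator `A` with `A (b ⊗ 1) = (b ⊗ 1) A` for `b ∈ M'` becomes an element of `M`. -/
lemma RightModularUnitary.conj_mem {L : Type*} [NormedAddCommGroup L] [InnerProductSpace ℂ L]
    (V : RightModularUnitary S L) {A : HilbertTensor H K →L[ℂ] HilbertTensor H L}
    (hA : ∀ b ∈ M.commutant, A ∘L HilbertTensor.rmap K b = HilbertTensor.rmap L b ∘L A) :
    V.op ∘L A ∘L U.opAdj ∈ M := by
  refine mem_of_commutes fun b hb => ?_
  rw [← ContinuousLinearMap.comp_assoc, ← V.op_comp_rmap hb, ContinuousLinearMap.comp_assoc,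
    ← ContinuousLinearMap.comp_assoc _ A, ← hA b hb, ContinuousLinearMap.comp_assoc,
    U.rmap_comp_opAdj hb]
  simp only [ContinuousLinearMap.comp_assoc]

/-- Conversely, an element of `M` becomes an operator which commutes with `b ⊗ 1` for `b ∈ M'`. -/
lemma RightModularUnitary.opAdj_comp_comp_op {L : Type*} [NormedAddCommGroup L]
    [InnerProductSpace ℂ L] (V : RightModularUnitary S L) {T : H →L[ℂ] H} (hT : T ∈ M)
    {b : H →L[ℂ] H} (hb : b ∈ M.commutant) :
    (V.opAdj ∘L T ∘L U.op) ∘L HilbertTensor.rmap K b =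
      HilbertTensor.rmap L b ∘L (V.opAdj ∘L T ∘L U.op) := by
  ext1 ζ
  have h1 := congrArg (fun A => V.opAdj (T (A ζ))) (U.op_comp_rmap hb)
  have h2 := congrArg (fun A : H →L[ℂ] H => V.opAdj (A (U.op ζ))) (commutes_of_mem hT hb)
  have h3 := congrArg (fun A => A (T (U.op ζ))) (V.rmap_comp_opAdj hb)
  exact h1.trans (h2.symm.trans h3.symm)

end RightModularUnitary

end VonNeumannAlgebra

/-! ### Polar decomposition and the Cantor–Bernstein theorem for intertwiners -/

section Intertwiners

open ContinuousLinearMap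

variable {E F : Type*} [NormedAddCommGroup E] [InnerProductSpace ℂ E] [CompleteSpace E]
  [NormedAddCommGroup F] [InnerProductSpace ℂ F] [CompleteSpace F]

/-- If `x b = b' x` and `x b* = b'* x`, then `b x* = x* b'`. -/
lemma comp_adjoint_of_intertwines {x : E →L[ℂ] F} {b : E →L[ℂ] E} {b' : F →L[ℂ] F}
    (h : adjoint b' ∘L x = x ∘L adjoint b) : b ∘L adjoint x = adjoint x ∘L b' := by
  have h' := congrArg adjoint h
  simpa [adjoint_comp] using h'.symm

/-- The isometry in the polar decomposition of an injective operator `x`: it intertwines whatever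
`x` and `x*` intertwine. -/
lemma exists_isometry_of_injective {x : E →L[ℂ] F} (hx : ∀ ζ, x ζ = 0 → ζ = 0) :
    ∃ V : E →L[ℂ] F, (∀ ζ, ‖V ζ‖ = ‖ζ‖) ∧
      ∀ (b : E →L[ℂ] E) (b' : F →L[ℂ] F), b' ∘L x = x ∘L b → adjoint b' ∘L x = x ∘L adjoint b →
        b' ∘L V = V ∘L b := by
  let a : E →L[ℂ] E := adjoint x ∘L x
  have ha : 0 ≤ a := (nonneg_iff_isPositive a).2 (isPositive_adjoint_comp_self x)
  -- Here `r = |x|`. It is self-adjoint and injective, so its range is dense, and `‖r ζ‖ = ‖x ζ‖`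
  -- lets `r ζ ↦ x ζ` extend to an isometry `V`.
  let r : E →L[ℂ] E := CFC.sqrt a
  have hr : r * r = a := CFC.sqrt_mul_sqrt_self a ha
  have hr' : adjoint r = r := ((nonneg_iff_isPositive r).1 (CFC.sqrt_nonneg a)).isSelfAdjoint
  have hnorm : ∀ ζ, ‖x ζ‖ = ‖r ζ‖ := fun ζ => by
    have h1 : ⟪r ζ, r ζ⟫_ℂ = ⟪x ζ, x ζ⟫_ℂ := by
      rw [← adjoint_inner_right, hr', ← adjoint_inner_right]
      exact congrArg (fun A : E →L[ℂ] E => ⟪ζ, A ζ⟫_ℂ) hr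
    rw [← sq_eq_sq₀ (norm_nonneg _) (norm_nonneg _), @norm_sq_eq_re_inner ℂ, @norm_sq_eq_re_inner ℂ,
      h1]
  have hdense : DenseRange r := by
    have h1 : r.rangeᗮ = ⊥ := by
      rw [orthogonal_range, hr', Submodule.eq_bot_iff]
      intro ζ hζ
      apply hx
      rw [← norm_eq_zero, hnorm, norm_eq_zero]
      exact hζ
    have h2 := Submodule.topologicalClosure_eq_top_iff.2 h1
    have h3 := (Submodule.dense_iff_topologicalClosure_eq_top).2 h2
    exact h3
  let V : E →L[ℂ] F := x.toLinearMap.extendOfNorm r.toLinearMap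
  have hV : ∀ ζ, V (r ζ) = x ζ := fun ζ =>
    LinearMap.extendOfNorm_eq (f := x.toLinearMap) (e := r.toLinearMap) hdense
      ⟨1, fun y => by simpa using (hnorm y).le⟩ ζ
  refine ⟨V, fun ζ => ?_, fun b b' h1 h2 => ?_⟩
  · refine hdense.induction_on (p := fun ζ => ‖V ζ‖ = ‖ζ‖) ζ
      (isClosed_eq V.continuous.norm continuous_norm) fun y => ?_
    rw [hV, hnorm]
  -- Whatever commutes with `x* x` commutes with its square root `r`; the relation for `V` then
  -- follows on the dense range of `r`.
  · have h3 : Commute a b := by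
      change (adjoint x ∘L x) ∘L b = b ∘L (adjoint x ∘L x)
      rw [comp_assoc, ← h1, ← comp_assoc, ← comp_adjoint_of_intertwines h2, comp_assoc]
    have h4 : Commute r b := h3.cfcₙ_nnreal _
    ext ζ
    refine hdense.induction_on (p := fun ζ => (b' ∘L V) ζ = (V ∘L b) ζ) ζ
      (isClosed_eq (b' ∘L V).continuous (V ∘L b).continuous) fun y => ?_
    have h5 : b (r y) = r (b y) := (congrArg (fun A : E →L[ℂ] E => A y) h4.eq).symm
    have h6 : b' (x y) = x (b y) := congrArg (fun A : E →L[ℂ] F => A y) h1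
    change b' (V (r y)) = V (b (r y))
    rw [h5, hV, hV, h6]

/-- The orthogonal projection onto a closed subspace which is invariant under `b` and `b*` commutes
with `b`. -/
lemma starProjection_comm {N : Submodule ℂ E} [N.HasOrthogonalProjection] {b : E →L[ℂ] E}
    (h1 : ∀ ζ ∈ N, b ζ ∈ N) (h2 : ∀ ζ ∈ N, adjoint b ζ ∈ N) (ζ : E) :
    N.starProjection (b ζ) = b (N.starProjection ζ) := by
  refine Submodule.eq_starProjection_of_mem_of_inner_eq_zero
    (h1 _ (Submodule.starProjection_apply_mem _ _)) fun w hw => ?_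
  rw [← map_sub, ← adjoint_inner_right]
  exact Submodule.starProjection_inner_eq_zero _ _ (h2 w hw)

lemma adjoint_apply_self_of_isometry {V : E →L[ℂ] F} (hV : ∀ ζ, ‖V ζ‖ = ‖ζ‖) (ζ : E) :
    adjoint V (V ζ) = ζ :=
  congrArg (fun A : E →L[ℂ] E => A ζ) ((norm_map_iff_adjoint_comp_self V).1 hV)

/-- Cantor–Bernstein for Hilbert spaces: from isometries `V : E → F` and `W : F → E` one obtains a
unitary `E → F`, which intertwines whatever `V`, `W` and their adjoints intertwine. -/
lemma exists_unitary_of_isometries {V : E →L[ℂ] F} {W : F →L[ℂ] E} (hV : ∀ ζ, ‖V ζ‖ = ‖ζ‖)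
    (hW : ∀ η, ‖W η‖ = ‖η‖) :
    ∃ U : E ≃ₗᵢ[ℂ] F, ∀ (b : E →L[ℂ] E) (b' : F →L[ℂ] F),
      b' ∘L V = V ∘L b → adjoint b' ∘L V = V ∘L adjoint b →
      b ∘L W = W ∘L b' → adjoint b ∘L W = W ∘L adjoint b' →
      ∀ ζ, U (b ζ) = b' (U ζ) := by
  have hVV := adjoint_apply_self_of_isometry hV
  have hWW := adjoint_apply_self_of_isometry hW
  -- As in the set-theoretic proof, `T` traces a vector back through `W` and then `V`, and `e`
  -- projects onto the complement of the range of `W`. `N` consists of the vectors whose backward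
  -- trace never leaves the range of `W`. The unitary is `W*` on `N` and `V` on its complement.
  let T : E →L[ℂ] E := adjoint V ∘L adjoint W
  let e : E →L[ℂ] E := 1 - W ∘L adjoint W
  have he : ∀ ζ, e ζ = ζ - W (adjoint W ζ) := fun ζ => rfl
  let N : Submodule ℂ E := ⨅ n : ℕ, (e ∘L T ^ n).ker
  have hN : ∀ ζ, ζ ∈ N ↔ ∀ n, e ((T ^ n) ζ) = 0 := fun ζ => by
    rw [Submodule.mem_iInf]
    rfl
  have hNc : IsClosed (N : Set E) := by
    rw [Submodule.coe_iInf]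
    exact isClosed_iInter fun n => (e ∘L T ^ n).isClosed_ker
  have : CompleteSpace N := hNc.completeSpace_coe
  have hTN : ∀ ζ ∈ N, T ζ ∈ N := fun ζ hζ => by
    rw [hN] at hζ ⊢
    intro n
    have := hζ (n + 1)
    rwa [pow_succ] at this
  have hWN : ∀ ζ ∈ N, W (adjoint W ζ) = ζ := fun ζ hζ => by
    have := (hN ζ).1 hζ 0
    exact (sub_eq_zero.1 this).symm
  let U₀ : E →L[ℂ] F := V ∘L (1 - N.starProjection) + adjoint W ∘L N.starProjection
  have hU₀ : ∀ ζ, U₀ ζ = V (ζ - N.starProjection ζ) + adjoint W (N.starProjection ζ) :=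
    fun ζ => rfl
  have hU₀N : ∀ ζ ∈ N, U₀ ζ = adjoint W ζ := fun ζ hζ => by
    rw [hU₀, Submodule.starProjection_eq_self_iff.2 hζ, sub_self, map_zero, zero_add]
  have hU₀N' : ∀ ζ ∈ Nᗮ, U₀ ζ = V ζ := fun ζ hζ => by
    rw [hU₀, (Submodule.starProjection_apply_eq_zero_iff (K := N)).2 hζ, sub_zero, map_zero,
      add_zero]
  have hiso : ∀ ζ, ‖U₀ ζ‖ = ‖ζ‖ := fun ζ => by
    have hn : N.starProjection ζ ∈ N := Submodule.starProjection_apply_mem _ _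
    -- The two images are orthogonal because `V* W* = T` maps `N` into itself.
    have h1 : ⟪V (ζ - N.starProjection ζ), adjoint W (N.starProjection ζ)⟫_ℂ = 0 := by
      rw [← adjoint_inner_right]
      exact Submodule.starProjection_inner_eq_zero _ _ (hTN _ hn)
    have h2 : ⟪ζ - N.starProjection ζ, N.starProjection ζ⟫_ℂ = 0 :=
      Submodule.starProjection_inner_eq_zero _ _ hn
    have h3 : ‖adjoint W (N.starProjection ζ)‖ = ‖N.starProjection ζ‖ := by
      rw [← hW, hWN _ hn]
    have h4 := norm_add_sq_eq_norm_sq_add_norm_sq_of_inner_eq_zero _ _ h1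
    have h5 := norm_add_sq_eq_norm_sq_add_norm_sq_of_inner_eq_zero _ _ h2
    rw [sub_add_cancel] at h5
    rw [← hU₀, hV, h3, ← h5] at h4
    nlinarith [norm_nonneg (U₀ ζ), norm_nonneg ζ]
  have hsurj : Function.Surjective U₀ := by
    let U₁ : E →ₗᵢ[ℂ] F := ⟨U₀.toLinearMap, hiso⟩
    have hcl : IsClosed (U₀.range : Set F) := U₁.isometry.isClosedEmbedding.isClosed_range
    have : CompleteSpace U₀.range := hcl.completeSpace_coe
    -- For `η` orthogonal to the range, `V* η ∈ N`, and `T (W η) = V* η` puts `W η` in `N`. Then `η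
    -- = W* (W η) = U₀ (W η)` lies in the range as well, so `η = 0`.
    have h1 : U₀.rangeᗮ = ⊥ := by
      rw [Submodule.eq_bot_iff]
      intro η hη
      rw [orthogonal_range] at hη
      have hη' : ∀ ζ, ⟪U₀ ζ, η⟫_ℂ = 0 := fun ζ => by
        rw [← adjoint_inner_right]
        have : adjoint U₀ η = 0 := hη
        rw [this, inner_zero_right]
      have h2 : adjoint V η ∈ N := by
        rw [← Submodule.orthogonal_orthogonal N, Submodule.mem_orthogonal]
        intro s hs
        rw [adjoint_inner_right, ← hU₀N' s hs]
        exact hη' s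
      have h3 : W η ∈ N := by
        rw [hN]
        intro n
        cases n with
        | zero =>
          change e (W η) = 0
          rw [he, hWW, sub_self]
        | succ n =>
          rw [pow_succ]
          have : T (W η) = adjoint V η := by
            change adjoint V (adjoint W (W η)) = _
            rw [hWW]
          change e ((T ^ n) (T (W η))) = 0
          rw [this]
          exact (hN _).1 h2 n
      have h4 := hη' (W η)
      rw [hU₀N _ h3, hWW] at h4
      exact inner_self_eq_zero.1 h4
    have h2 := Submodule.orthogonal_eq_bot_iff.1 h1
    exact LinearMap.range_eq_top.1 h2
  let U₁ : E →ₗᵢ[ℂ] F := ⟨U₀.toLinearMap, hiso⟩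
  refine ⟨LinearIsometryEquiv.ofSurjective U₁ hsurj, fun b b' h1 h2 h3 h4 ζ => ?_⟩
  have h5 := comp_adjoint_of_intertwines h2
  have h6 := comp_adjoint_of_intertwines h4
  have h7 : adjoint b ∘L adjoint V = adjoint V ∘L adjoint b' :=
    comp_adjoint_of_intertwines (by rwa [adjoint_adjoint, adjoint_adjoint])
  have h8 : adjoint b' ∘L adjoint W = adjoint W ∘L adjoint b :=
    comp_adjoint_of_intertwines (by rwa [adjoint_adjoint, adjoint_adjoint])
  -- `N` is cut out by `T` and `e`, which commute with `c`. Used for `b` and for `b*`, this shows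
  -- that the projection onto `N` commutes with `b`.
  have key : ∀ (c : E →L[ℂ] E) (c' : F →L[ℂ] F), c ∘L adjoint V = adjoint V ∘L c' →
      c' ∘L adjoint W = adjoint W ∘L c → c ∘L W = W ∘L c' → ∀ ζ ∈ N, c ζ ∈ N := by
    intro c c' k1 k2 k3 ζ hζ
    have k4 : Commute c T := by
      change c ∘L adjoint V ∘L adjoint W = (adjoint V ∘L adjoint W) ∘L c
      rw [← comp_assoc, k1, comp_assoc, k2, comp_assoc]
    have k5 : Commute c e := by
      refine (Commute.one_right c).sub_right ?_
      change c ∘L W ∘L adjoint W = (W ∘L adjoint W) ∘L c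
      rw [← comp_assoc, k3, comp_assoc, k2, comp_assoc]
    rw [hN] at hζ ⊢
    intro n
    have k6 := congrArg (fun A : E →L[ℂ] E => A ζ) (k5.mul_right (k4.pow_right n)).eq
    have k7 : c (e ((T ^ n) ζ)) = e ((T ^ n) (c ζ)) := k6
    rw [← k7, hζ, map_zero]
  have h9 := starProjection_comm (key b b' h5 h6 h3) (key _ _ h7 h8 h4) ζ
  change U₀ (b ζ) = b' (U₀ ζ)
  have h1' : ∀ ζ, b' (V ζ) = V (b ζ) := fun ζ => congrArg (fun A : E →L[ℂ] F => A ζ) h1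
  have h6' : ∀ ζ, b' (adjoint W ζ) = adjoint W (b ζ) :=
    fun ζ => congrArg (fun A : E →L[ℂ] F => A ζ) h6
  rw [hU₀, hU₀, h9, map_add, h1', h6', map_sub b]

end Intertwiners

/-! ### Right modular unitaries -/

section Existence

open ContinuousLinearMap

variable {H : Type v} [NormedAddCommGroup H] [InnerProductSpace ℂ H] [CompleteSpace H]
  {M : VonNeumannAlgebra H}

namespace VonNeumannAlgebra

/-- In a factor `M`, the vectors annihilated by `p M` for a nonzero `p ∈ M` are zero. -/
lemma IsFactor.exists_apply_ne_zero (hM : M.IsFactor) {p : H →L[ℂ] H} (hp : p ∈ M) (hp0 : p ≠ 0)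
    {ζ : H} (hζ : ζ ≠ 0) : ∃ b : M.Elem, p ((b : H →L[ℂ] H) ζ) ≠ 0 := by
  by_contra! hcon
  -- The common kernel of the `p b` is invariant under both `M` and `M'`, so its projection is
  -- central, hence scalar. As it contains `ζ ≠ 0` it is everything, and `b = 1` gives `p = 0`.
  let N : Submodule ℂ H := ⨅ b : M.Elem, (p ∘L (b : H →L[ℂ] H)).ker
  have hN : ∀ ξ, ξ ∈ N ↔ ∀ b : M.Elem, p ((b : H →L[ℂ] H) ξ) = 0 := fun ξ => by
    rw [Submodule.mem_iInf]
    rfl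
  have hNc : IsClosed (N : Set H) := by
    rw [Submodule.coe_iInf]
    exact isClosed_iInter fun b => (p ∘L (b : H →L[ℂ] H)).isClosed_ker
  have : CompleteSpace N := hNc.completeSpace_coe
  have h1 : ∀ y ∈ M.commutant, ∀ ξ ∈ N, y ξ ∈ N := fun y hy ξ hξ => by
    rw [hN] at hξ ⊢
    intro b
    have h := congrArg (fun A : H →L[ℂ] H => A ξ) (commutes_of_mem (mul_mem hp b.2) hy)
    have h' : y (p ((b : H →L[ℂ] H) ξ)) = p ((b : H →L[ℂ] H) (y ξ)) := h
    rw [← h', hξ, map_zero]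
  have h2 : ∀ y ∈ M, ∀ ξ ∈ N, y ξ ∈ N := fun y hy ξ hξ => by
    rw [hN] at hξ ⊢
    exact fun b => hξ (b * (⟨y, hy⟩ : M.Elem))
  have h3 : N.starProjection ∈ M := mem_of_commutes fun y hy => by
    ext ξ
    exact (starProjection_comm (h1 y hy) (h1 _ (star_mem hy)) ξ).symm
  have h4 : N.starProjection ∈ M.commutant := mem_commutant_iff.2 fun y hy => by
    ext ξ
    exact (starProjection_comm (h2 y hy) (h2 _ (star_mem hy)) ξ).symm
  obtain ⟨c, hc⟩ := hM.2 _ h3 h4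
  have h5 : ζ ∈ N := (hN ζ).2 hcon
  have h6 : c • ζ = ζ := by
    have := Submodule.starProjection_eq_self_iff.2 h5
    rwa [hc] at this
  have h7 : c = 1 := by
    have : (c - 1) • ζ = 0 := by rw [sub_smul, h6, one_smul, sub_self]
    exact sub_eq_zero.1 ((smul_eq_zero.1 this).resolve_right hζ)
  apply hp0
  ext ξ
  have h8 : ξ ∈ N := by
    rw [← Submodule.starProjection_eq_self_iff, hc, h7, one_smul]
    rfl
  exact (hN ξ).1 h8 1

/-- A type III algebra contains a proper isometry `w`; here `p = 1 - w w*`. -/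
lemma IsTypeIII.exists_isometry [Nontrivial H] (hIII : M.IsTypeIII) :
    ∃ w ∈ M, ∃ p ∈ M, star w * w = 1 ∧ p ≠ 0 ∧ star w * p = 0 ∧ p * w = 0 ∧ p * p = p := by
  obtain ⟨w, hw, h1, -, h2⟩ := hIII 1 (one_mem M) (.one _) one_ne_zero
  have h3 : star w * (1 - w * star w) = 0 := by
    rw [mul_sub, ← mul_assoc, h1, one_mul, mul_one, sub_self]
  refine ⟨w, hw, 1 - w * star w, sub_mem (one_mem M) (mul_mem hw (star_mem hw)), h1,
    sub_ne_zero.2 (Ne.symm h2), h3, ?_, ?_⟩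
  · rw [sub_mul, mul_assoc, h1, one_mul, mul_one, sub_self]
  · rw [sub_mul, mul_assoc, h3, one_mul, mul_zero, sub_zero]

end VonNeumannAlgebra

/-- The wandering subspaces `wᵏ p H` of the isometry `w` are mutually orthogonal; `p w*ʲ` reads off
the component in the `j`-th one. -/
lemma mul_star_pow_mul_pow_mul {w p : H →L[ℂ] H} (h1 : star w * w = 1) (h2 : star w * p = 0)
    (h3 : p * w = 0) (h4 : p * p = p) (j k : ℕ) :
    p * (star w ^ j * (w ^ k * p)) = if j = k then p else 0 := by
  induction j generalizing k with
  | zero =>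
    cases k with
    | zero => simp [h4]
    | succ k => rw [pow_zero, one_mul, pow_succ', mul_assoc, ← mul_assoc, h3, zero_mul]; simp
  | succ j ih =>
    cases k with
    | zero => rw [pow_zero, one_mul, pow_succ, mul_assoc, h2, mul_zero, mul_zero]; simp
    | succ k =>
      rw [pow_succ, pow_succ', mul_assoc, mul_assoc, ← mul_assoc (star w), h1, one_mul, ih k]
      simp

/-- A jointly injective sequence of operators into the range of `p = 1 - w w*` can be combined to
one injective operator, by means of the orthogonal subspaces `wᵏ p H`. -/
lemma exists_injective_of_jointly_injective {E : Type*} [NormedAddCommGroup E]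
    [InnerProductSpace ℂ E] {w p : H →L[ℂ] H} (h1 : star w * w = 1) (h2 : star w * p = 0)
    (h3 : p * w = 0) (h4 : p * p = p) (v : ℕ → E →L[ℂ] H)
    (hv : ∀ ζ, (∀ k, p (v k ζ) = 0) → ζ = 0) :
    ∃ x : E →L[ℂ] H, (∀ ζ, x ζ = 0 → ζ = 0) ∧
      ∀ (b : E →L[ℂ] E) (b' : H →L[ℂ] H), b' ∘L w = w ∘L b' → b' ∘L p = p ∘L b' →
        (∀ k, b' ∘L v k = v k ∘L b) → b' ∘L x = x ∘L b := by
  let u : ℕ → E →L[ℂ] H := fun k => (w ^ k * p) ∘L v k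
  -- The weights give `‖c k • u k‖ ≤ 2⁻ᵏ`, so the series converges in norm, and they are nonzero, so
  -- each component of `x` can be recovered.
  let c : ℕ → ℂ := fun k => (((1 / 2 : ℝ) ^ k * (1 + ‖u k‖)⁻¹ : ℝ) : ℂ)
  have hc : ∀ k, c k ≠ 0 := fun k => by
    have : (0 : ℝ) < (1 / 2 : ℝ) ^ k * (1 + ‖u k‖)⁻¹ := by positivity
    exact Complex.ofReal_ne_zero.2 this.ne'
  have hsum : Summable fun k => c k • u k := by
    refine Summable.of_norm_bounded (g := fun k => (1 / 2 : ℝ) ^ k)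
      (summable_geometric_of_lt_one (by norm_num) (by norm_num)) fun k => ?_
    have h : (0 : ℝ) ≤ (1 / 2 : ℝ) ^ k * (1 + ‖u k‖)⁻¹ := by positivity
    rw [norm_smul, Complex.norm_real, Real.norm_of_nonneg h, mul_assoc]
    refine mul_le_of_le_one_right (by positivity) ?_
    rw [inv_mul_le_one₀ (by positivity)]
    linarith
  obtain ⟨x, hx⟩ := hsum
  refine ⟨x, fun ζ hζ => hv ζ fun j => ?_, fun b b' hw hp hb => ?_⟩
  · have hs := (compL ℂ E H H (p * star w ^ j)).hasSum hx
    have hs' : HasSum (fun k => (p * star w ^ j) ∘L (c k • u k)) (c j • (p ∘L v j)) := by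
      have hterm : ∀ k, (p * star w ^ j) ∘L (c k • u k)
          = c k • ((p * (star w ^ j * (w ^ k * p))) ∘L v k) := fun k => by
        rw [ContinuousLinearMap.comp_smul]
        rfl
      have hj : (p * star w ^ j) ∘L (c j • u j) = c j • (p ∘L v j) := by
        rw [hterm, mul_star_pow_mul_pow_mul h1 h2 h3 h4, if_pos rfl]
      rw [← hj]
      refine hasSum_single j fun k hk => ?_
      rw [hterm, mul_star_pow_mul_pow_mul h1 h2 h3 h4, if_neg (Ne.symm hk)]
      simp
    have h5 := congrArg (fun A : E →L[ℂ] H => A ζ) (hs.unique hs')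
    have h6 : (p * star w ^ j) (x ζ) = c j • p (v j ζ) := h5
    rw [hζ, map_zero, eq_comm, smul_eq_zero] at h6
    exact h6.resolve_left (hc j)
  · have hs := (compL ℂ E H H b').hasSum hx
    have hs' := ((compL ℂ E E H).flip b).hasSum hx
    refine hs.unique (hs'.congr_fun fun k => ?_)
    have hwk : Commute b' (w ^ k * p) :=
      ((show Commute b' w from hw).pow_right k).mul_right (show Commute b' p from hp)
    have hwk' : b' ∘L (w ^ k * p) = (w ^ k * p) ∘L b' := hwk.eq
    change b' ∘L (c k • u k) = (c k • u k) ∘L b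
    rw [ContinuousLinearMap.comp_smul, ContinuousLinearMap.smul_comp, comp_assoc, ← hb k,
      ← comp_assoc, ← comp_assoc, hwk']

namespace VonNeumannAlgebra

/-- Countably many elements of `p M` suffice to separate the vectors of a separable space. -/
lemma IsFactor.exists_countable_separating [TopologicalSpace.SeparableSpace H] (hM : M.IsFactor)
    {p : H →L[ℂ] H} (hp : p ∈ M) (hp0 : p ≠ 0) :
    ∃ b : ℕ → M.Elem, ∀ ζ : H, (∀ n, p ((b n : H →L[ℂ] H) ζ) = 0) → ζ = 0 := by
  have : SecondCountableTopology H := UniformSpace.secondCountable_of_separable H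
  -- Lindelöf: the open sets on which `p b` does not vanish cover the nonzero vectors, and countably
  -- many of them have the same union.
  obtain ⟨T, hT, hU⟩ := TopologicalSpace.isOpen_iUnion_countable
    (fun b : M.Elem => {ζ : H | p ((b : H →L[ℂ] H) ζ) ≠ 0})
    (fun b => isOpen_ne_fun (p ∘L (b : H →L[ℂ] H)).continuous continuous_const)
  -- Adjoining `0` makes the index set nonempty, so that `ℕ` enumerates it.
  have hT' : (insert 0 T).Countable := hT.insert 0
  obtain ⟨b, hb⟩ := hT'.exists_eq_range (Set.insert_nonempty _ _)
  refine ⟨b, fun ζ hζ => ?_⟩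
  by_contra h
  obtain ⟨a, ha⟩ := hM.exists_apply_ne_zero hp hp0 h
  have h1 : ζ ∈ ⋃ b : M.Elem, {ζ : H | p ((b : H →L[ℂ] H) ζ) ≠ 0} := Set.mem_iUnion.2 ⟨a, ha⟩
  rw [← hU] at h1
  simp only [Set.mem_iUnion] at h1
  obtain ⟨d, hd, hd'⟩ := h1
  have h2 : d ∈ Set.range b := hb ▸ Set.mem_insert_of_mem 0 hd
  obtain ⟨n, rfl⟩ := h2
  exact hd' (hζ n)

/-- For a type III factor `M` and a nonzero separable Hilbert space `K`, the right modules
`L²(M) ⊗ K` and `L²(M)` are unitarily equivalent. -/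
theorem nonempty_rightModularUnitary [TopologicalSpace.SeparableSpace H] (hM : M.IsFactor)
    (hIII : M.IsTypeIII) (S : StandardForm M) (K : Type w) [NormedAddCommGroup K]
    [InnerProductSpace ℂ K] [TopologicalSpace.SeparableSpace K] [Nontrivial K] :
    Nonempty (RightModularUnitary S K) := by
  have := hM.1
  obtain ⟨w, hw, p, hp, h1, hp0, h2, h3, h4⟩ := hIII.exists_isometry
  obtain ⟨b, hb⟩ := hM.exists_countable_separating hp hp0
  let f : ℕ → K := TopologicalSpace.denseSeq K
  -- `k` codes a pair `(n, m)`: slice along the `m`-th vector of a dense sequence in `K`, then apply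
  -- `bₙ`.
  let v : ℕ → HilbertTensor H K →L[ℂ] H := fun k =>
    (b k.unpair.1 : H →L[ℂ] H) ∘L adjoint (HilbertTensor.tmulRight H (f k.unpair.2))
  have hadj : ∀ (g : K) (y : H →L[ℂ] H), y ∘L adjoint (HilbertTensor.tmulRight H g) =
      adjoint (HilbertTensor.tmulRight H g) ∘L HilbertTensor.rmap K y := fun g y => by
    have h := congrArg adjoint (HilbertTensor.rmap_comp_tmulRight (adjoint y) g)
    rwa [adjoint_comp, adjoint_comp, HilbertTensor.adjoint_rmap, adjoint_adjoint, eq_comm] at h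
  have hv : ∀ ζ, (∀ k, p (v k ζ) = 0) → ζ = 0 := fun ζ hζ => by
    have h5 : ∀ m, adjoint (HilbertTensor.tmulRight H (f m)) ζ = 0 := fun m =>
      hb _ fun n => by simpa [v] using hζ (Nat.pair n m)
    refine HilbertTensor.eq_zero_of_inner_tmul fun ξ g => ?_
    refine (TopologicalSpace.denseRange_denseSeq K).induction_on
      (p := fun g => ⟪HilbertTensor.tmul ξ g, ζ⟫_ℂ = 0) g ?_ fun m => ?_
    · refine isClosed_eq (Continuous.inner ?_ continuous_const) continuous_const
      exact (UniformSpace.Completion.continuous_coe _).comp (TensorProduct.mkL ℂ H K ξ).continuous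
    · rw [← HilbertTensor.tmulRight_apply, ← adjoint_inner_right]
      exact (congrArg _ (h5 m)).trans (inner_zero_right _)
  obtain ⟨x, hx, hxb⟩ := exists_injective_of_jointly_injective h1 h2 h3 h4 v hv
  have hxM : ∀ y ∈ M.commutant, y ∘L x = x ∘L HilbertTensor.rmap K y := fun y hy => by
    refine hxb _ _ (commutes_of_mem hw hy) (commutes_of_mem hp hy) fun k => ?_
    rw [← comp_assoc, commutes_of_mem (b k.unpair.1).2 hy, comp_assoc, hadj, comp_assoc]
  obtain ⟨V, hV, hVb⟩ := exists_isometry_of_injective hx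
  have hstar : ∀ y ∈ M.commutant, adjoint y ∈ M.commutant := fun y hy => star_mem hy
  have hVM : ∀ y ∈ M.commutant, y ∘L V = V ∘L HilbertTensor.rmap K y := fun y hy => by
    refine hVb _ _ (hxM y hy) ?_
    rw [HilbertTensor.adjoint_rmap]
    exact hxM _ (hstar y hy)
  -- A unit vector `g` gives the isometry `ξ ↦ ξ ⊗ g` in the opposite direction.
  obtain ⟨g, hg⟩ := exists_norm_eq K zero_le_one
  obtain ⟨U, hU⟩ := exists_unitary_of_isometries (W := HilbertTensor.tmulRight H g) hV fun ξ => by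
    rw [HilbertTensor.tmulRight_apply, HilbertTensor.norm_tmul, hg, mul_one]
  refine ⟨⟨U, fun n hn ζ => ?_⟩⟩
  have hn' := S.rightMul_mem hn
  refine hU _ _ (hVM _ hn') ?_ (HilbertTensor.rmap_comp_tmulRight _ _) ?_ ζ
  · rw [HilbertTensor.adjoint_rmap]
    exact hVM _ (hstar _ hn')
  · rw [HilbertTensor.adjoint_rmap]
    exact HilbertTensor.rmap_comp_tmulRight _ _

end VonNeumannAlgebra

end Existence

/-- The constant function `1` is square integrable, and its norm is a positive power of the total
mass. -/
lemma ConcreteModule.nontrivial_L2 {G : Type u} [TopologicalSpace G] [MeasurableSpace G]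
    (X : ConcreteModule G) : Nontrivial X.L2 := by
  refine ⟨⟨indicatorConstLp 2 MeasurableSet.univ (measure_ne_top X.μ _) (1 : ℂ), 0, fun h => ?_⟩⟩
  have h1 := norm_indicatorConstLp (p := 2) (hs := MeasurableSet.univ)
    (hμs := measure_ne_top X.μ _) (c := (1 : ℂ)) two_ne_zero (by simp)
  rw [h, norm_zero, norm_one, one_mul, eq_comm, Real.rpow_eq_zero_iff_of_nonneg measureReal_nonneg,
    measureReal_eq_zero_iff, Measure.measure_univ_eq_zero] at h1
  exact X.ne_zero h1.1

/-! ### The representations `σ_X` -/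

section Sigma

open ContinuousLinearMap

variable {G : Type u} [Group G] [TopologicalSpace G] [MeasurableSpace G]
  {H : Type v} [NormedAddCommGroup H] [InnerProductSpace ℂ H] [CompleteSpace H]

section TensorToLp

variable {X : Type w} [MeasurableSpace X] (μ : Measure X)

lemma inner_tensorToLp (ζ ζ' : HilbertTensor H (Lp ℂ 2 μ)) :
    ⟪tensorToLp μ ζ, tensorToLp μ ζ'⟫_ℂ = ⟪ζ, ζ'⟫_ℂ := by
  rw [← adjoint_inner_right]
  have h : adjoint (tensorToLp (H := H) μ) ∘L tensorToLp μ = ContinuousLinearMap.id ℂ _ := by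
    refine HilbertTensor.clm_ext_inner fun ξ f η k => ?_
    rw [ContinuousLinearMap.comp_apply, adjoint_inner_right]
    simpa [tensorToLp, HilbertTensor.tmul] using
      inner_tensorToLpAux μ (η ⊗ₜ[ℂ] k) (ξ ⊗ₜ[ℂ] f)
  exact congrArg (fun A => ⟪ζ, A ζ'⟫_ℂ) h

lemma norm_tensorToLp (ζ : HilbertTensor H (Lp ℂ 2 μ)) : ‖tensorToLp μ ζ‖ = ‖ζ‖ := by
  rw [← sq_eq_sq₀ (norm_nonneg _) (norm_nonneg _), @norm_sq_eq_re_inner ℂ, @norm_sq_eq_re_inner ℂ,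
    inner_tensorToLp]

/-- The range of an isometry is closed, and it contains the functions `1_s ξ`, which span a dense
subspace. The adjoint is thus the inverse, and operators may be compared in `L²(X, H)`. -/
lemma tensorToLp_surjective : Function.Surjective (tensorToLp (H := H) μ) := by
  let T : HilbertTensor H (Lp ℂ 2 μ) →ₗᵢ[ℂ] Lp H 2 μ :=
    ⟨(tensorToLp μ).toLinearMap, norm_tensorToLp μ⟩
  have hcl : IsClosed (Set.range (tensorToLp (H := H) μ)) :=
    T.isometry.isClosedEmbedding.isClosed_range
  intro F
  have : Fact ((1 : ℝ≥0∞) ≤ 2) := ⟨by norm_num⟩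
  refine Lp.induction (by simp) (motive := fun F => F ∈ Set.range (tensorToLp (H := H) μ))
    ?_ ?_ hcl F
  · intro ξ s hs hμs
    refine ⟨HilbertTensor.tmul ξ (indicatorConstLp 2 hs hμs.ne 1), ?_⟩
    rw [Lp.simpleFunc.coe_indicatorConst]
    apply Lp.ext
    filter_upwards [tensorToLp_tmul μ ξ (indicatorConstLp 2 hs hμs.ne 1),
      indicatorConstLp_coeFn (p := 2) (hs := hs) (hμs := hμs.ne) (c := (1 : ℂ)),
      indicatorConstLp_coeFn (p := 2) (hs := hs) (hμs := hμs.ne) (c := ξ)] with x h1 h2 h3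
    rw [h1, h2, h3]
    by_cases hx : x ∈ s <;> simp [hx]
  · rintro f g hf hg - ⟨a, ha⟩ ⟨b, hb⟩
    exact ⟨a + b, by rw [map_add, ha, hb]⟩

lemma adjoint_tensorToLp_apply (ζ : HilbertTensor H (Lp ℂ 2 μ)) :
    adjoint (tensorToLp μ) (tensorToLp μ ζ) = ζ :=
  ext_inner_left ℂ fun ζ' => by rw [adjoint_inner_right, inner_tensorToLp]

lemma tensorToLp_adjoint (F : Lp H 2 μ) : tensorToLp μ (adjoint (tensorToLp μ) F) = F := by
  obtain ⟨ζ, rfl⟩ := tensorToLp_surjective μ F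
  rw [adjoint_tensorToLp_apply]

lemma tensorToLp_injective : Function.Injective (tensorToLp (H := H) μ) :=
  fun ζ ζ' h => by
    rw [← adjoint_tensorToLp_apply μ ζ, h, adjoint_tensorToLp_apply]

lemma tensorToLp_rmap (b : H →L[ℂ] H) (ζ : HilbertTensor H (Lp ℂ 2 μ)) :
    tensorToLp μ (HilbertTensor.rmap _ b ζ) =ᵐ[μ] fun x => b (tensorToLp μ ζ x) := by
  have h : tensorToLp μ ∘L HilbertTensor.rmap _ b = b.compLpL 2 μ ∘L tensorToLp μ := by
    refine HilbertTensor.clm_ext fun ξ f => Lp.ext ?_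
    rw [ContinuousLinearMap.comp_apply, ContinuousLinearMap.comp_apply, HilbertTensor.rmap_tmul]
    filter_upwards [tensorToLp_tmul μ (b ξ) f, tensorToLp_tmul μ ξ f,
      coeFn_compLpL b (tensorToLp μ (HilbertTensor.tmul ξ f))] with x h1 h2 h3
    rw [h1, h3, h2, map_smul]
  have h' := congrArg (fun A => A ζ) h
  change tensorToLp μ (HilbertTensor.rmap _ b ζ) = b.compLpL 2 μ (tensorToLp μ ζ) at h'
  rw [h']
  exact coeFn_compLpL b _

end TensorToLp

variable [TopologicalSpace.SeparableSpace H] {M : VonNeumannAlgebra H} {θ : GKernel G M}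
  (α : BorelLift θ) (X : ConcreteModule G)

/-- This pointwise form reduces the algebraic properties of `σ_X` to those of the automorphisms
`α_{g(x)}`. -/
lemma tensorToLp_sigmaOp (m : M.Elem) (ζ : HilbertTensor H X.L2) :
    tensorToLp X.μ (sigmaOp α X m ζ) =ᵐ[X.μ]
      fun x => (α.toFun (X.g x) m : H →L[ℂ] H) (tensorToLp X.μ ζ x) := by
  simp only [sigmaOp, ContinuousLinearMap.comp_apply]
  rw [tensorToLp_adjoint]
  exact decomposable_coeFn X.μ _ _ _ _ _

lemma sigmaOp_one : sigmaOp α X 1 = ContinuousLinearMap.id ℂ _ := by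
  ext1 ζ
  apply tensorToLp_injective
  apply Lp.ext
  filter_upwards [tensorToLp_sigmaOp α X 1 ζ] with x h1
  rw [h1, map_one]
  rfl

lemma sigmaOp_mul (m n : M.Elem) : sigmaOp α X (m * n) = sigmaOp α X m ∘L sigmaOp α X n := by
  ext1 ζ
  apply tensorToLp_injective
  apply Lp.ext
  rw [ContinuousLinearMap.comp_apply]
  filter_upwards [tensorToLp_sigmaOp α X (m * n) ζ, tensorToLp_sigmaOp α X n ζ,
    tensorToLp_sigmaOp α X m (sigmaOp α X n ζ)] with x h1 h2 h3
  rw [h1, h3, h2, map_mul]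
  rfl

lemma sigmaOp_add (m n : M.Elem) : sigmaOp α X (m + n) = sigmaOp α X m + sigmaOp α X n := by
  ext1 ζ
  apply tensorToLp_injective
  apply Lp.ext
  rw [add_apply, map_add]
  filter_upwards [tensorToLp_sigmaOp α X (m + n) ζ, tensorToLp_sigmaOp α X n ζ,
    tensorToLp_sigmaOp α X m ζ, Lp.coeFn_add (tensorToLp X.μ (sigmaOp α X m ζ))
      (tensorToLp X.μ (sigmaOp α X n ζ))] with x h1 h2 h3 h4
  rw [h1, h4, Pi.add_apply, h2, h3, map_add]
  rfl

lemma sigmaOp_smul (c : ℂ) (m : M.Elem) : sigmaOp α X (c • m) = c • sigmaOp α X m := by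
  ext1 ζ
  apply tensorToLp_injective
  apply Lp.ext
  rw [smul_apply, map_smul]
  filter_upwards [tensorToLp_sigmaOp α X (c • m) ζ, tensorToLp_sigmaOp α X m ζ,
    Lp.coeFn_smul c (tensorToLp X.μ (sigmaOp α X m ζ))] with x h1 h2 h3
  rw [h1, h3, Pi.smul_apply, h2, map_smul]
  rfl

lemma inner_sigmaOp_left (m : M.Elem) (ζ ζ' : HilbertTensor H X.L2) :
    ⟪ζ, sigmaOp α X m ζ'⟫_ℂ = ∫ x, ⟪tensorToLp X.μ ζ x,
      (α.toFun (X.g x) m : H →L[ℂ] H) (tensorToLp X.μ ζ' x)⟫_ℂ ∂X.μ := by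
  rw [← inner_tensorToLp, L2.inner_def]
  refine integral_congr_ae ?_
  filter_upwards [tensorToLp_sigmaOp α X m ζ'] with x h1
  rw [h1]

lemma sigmaOp_star (m : M.Elem) : sigmaOp α X (star m) = adjoint (sigmaOp α X m) := by
  rw [eq_adjoint_iff]
  intro ζ ζ'
  rw [← inner_conj_symm, inner_sigmaOp_left, inner_sigmaOp_left, ← integral_conj]
  refine integral_congr_ae (Filter.Eventually.of_forall fun x => ?_)
  simp only [inner_conj_symm]
  rw [map_star, ← adjoint_inner_left]
  rfl

lemma sigmaOp_comp_rmap {b : H →L[ℂ] H} (hb : b ∈ M.commutant) (m : M.Elem) :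
    sigmaOp α X m ∘L HilbertTensor.rmap X.L2 b = HilbertTensor.rmap X.L2 b ∘L sigmaOp α X m := by
  ext1 ζ
  apply tensorToLp_injective
  apply Lp.ext
  rw [ContinuousLinearMap.comp_apply, ContinuousLinearMap.comp_apply]
  filter_upwards [tensorToLp_sigmaOp α X m (HilbertTensor.rmap X.L2 b ζ),
    tensorToLp_rmap X.μ b ζ, tensorToLp_rmap X.μ b (sigmaOp α X m ζ),
    tensorToLp_sigmaOp α X m ζ] with x h1 h2 h3 h4
  rw [h1, h3, h2, h4]
  exact congrArg (fun A : H →L[ℂ] H => A (tensorToLp X.μ ζ x))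
    (VonNeumannAlgebra.commutes_of_mem (α.toFun (X.g x) m).2 hb).symm

end Sigma

/-! ### Equivariance for bounded Borel functions -/

section Borel

variable {G : Type u} [TopologicalSpace G] [MeasurableSpace G]
  [CompactSpace G] [T2Space G] [SecondCountableTopology G] [BorelSpace G]

/-- The functional `φ ↦ ∫ φ ∘ g F dμ` is `L¹`-bounded for the image under `g` of the measure `|F|
μ`. -/
lemma enorm_integral_comp_mul_le {X : Type*} [MeasurableSpace X] {μ : Measure X} {g : X → G}
    (hg : Measurable g) {F : X → ℂ} (hF : Integrable F μ) {φ : G → ℂ} (hφ : Measurable φ) :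
    ‖∫ x, φ (g x) * F x ∂μ‖ₑ ≤
      ∫⁻ y, ‖φ y‖ₑ ∂((μ.withDensity fun x => ‖F x‖ₑ).map g) := by
  refine (enorm_integral_le_lintegral_enorm _).trans ?_
  rw [lintegral_map hφ.enorm hg, lintegral_withDensity_eq_lintegral_mul₀ hF.1.enorm
    (f := fun x => ‖F x‖ₑ) (g := fun x => ‖φ (g x)‖ₑ) (hφ.comp hg).enorm.aemeasurable]
  refine lintegral_mono fun x => ?_
  simp [enorm_mul, mul_comm]

lemma integral_comp_mul_sub_add {X : Type*} [MeasurableSpace X] {μ : Measure X} {g : X → G}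
    (hg : Measurable g) {F : X → ℂ} (hF : Integrable F μ) {φ ψ : G → ℂ} (hφψ : Measurable (φ - ψ))
    (hψ : Measurable ψ) {C D : ℝ} (hC : ∀ y, ‖(φ - ψ) y‖ ≤ C) (hD : ∀ y, ‖ψ y‖ ≤ D) :
    ∫ x, φ (g x) * F x ∂μ = ∫ x, (φ - ψ) (g x) * F x ∂μ + ∫ x, ψ (g x) * F x ∂μ := by
  have h1 : Integrable (fun x => (φ - ψ) (g x) * F x) μ :=
    hF.bdd_mul (hφψ.comp hg).aestronglyMeasurable (Filter.Eventually.of_forall fun x => hC (g x))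
  have h2 : Integrable (fun x => ψ (g x) * F x) μ :=
    hF.bdd_mul (hψ.comp hg).aestronglyMeasurable (Filter.Eventually.of_forall fun x => hD (g x))
  rw [← integral_add h1 h2]
  refine integral_congr_ae (Filter.Eventually.of_forall fun x => ?_)
  simp only [Pi.sub_apply]
  ring

/-- If `∫ φ ∘ g₁ F₁ dμ₁ = ∫ φ ∘ g₂ F₂ dμ₂` for continuous `φ`, then also for bounded Borel `φ`. -/
lemma integral_comp_mul_eq_of_continuous {X Y : Type*} [MeasurableSpace X] [MeasurableSpace Y]
    {μ : Measure X} {ν : Measure Y} {g : X → G} {k : Y → G} (hg : Measurable g) (hk : Measurable k)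
    {A : X → ℂ} {B : Y → ℂ} (hA : Integrable A μ) (hB : Integrable B ν)
    (h : ∀ ψ : C(G, ℂ), ∫ x, ψ (g x) * A x ∂μ = ∫ y, ψ (k y) * B y ∂ν)
    {φ : G → ℂ} (hφ : Measurable φ) {C : ℝ} (hC : ∀ y, ‖φ y‖ ≤ C) :
    ∫ x, φ (g x) * A x ∂μ = ∫ y, φ (k y) * B y ∂ν := by
  let μ' : Measure G := (μ.withDensity fun x => ‖A x‖ₑ).map g
  let ν' : Measure G := (ν.withDensity fun y => ‖B y‖ₑ).map k
  have : IsFiniteMeasure (μ.withDensity fun x => ‖A x‖ₑ) :=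
    isFiniteMeasure_withDensity hA.2.ne
  have : IsFiniteMeasure (ν.withDensity fun y => ‖B y‖ₑ) :=
    isFiniteMeasure_withDensity hB.2.ne
  have : IsFiniteMeasure μ' := Measure.isFiniteMeasure_map _ _
  have : IsFiniteMeasure ν' := Measure.isFiniteMeasure_map _ _
  -- With the sum of the two controlling measures, one continuous approximant `ψ` serves both
  -- integrals and the two errors add up to at most `ε`.
  have hmem : MemLp φ 1 (μ' + ν') :=
    MemLp.of_bound hφ.aestronglyMeasurable C (Filter.Eventually.of_forall hC)
  rw [← sub_eq_zero, ← enorm_eq_zero, ← nonpos_iff_eq_zero]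
  refine le_of_forall_pos_le_add fun ε hε => ?_
  rw [zero_add]
  obtain ⟨ψ, hψ, -⟩ := hmem.exists_boundedContinuous_eLpNorm_sub_le ENNReal.one_ne_top hε.ne'
  rw [eLpNorm_one_eq_lintegral_enorm, lintegral_add_measure] at hψ
  have hψm : Measurable ψ := ψ.continuous.measurable
  have hb : ∀ y, ‖(φ - ψ) y‖ ≤ C + ‖ψ‖ := fun y =>
    (norm_sub_le _ _).trans (add_le_add (hC y) (ψ.norm_coe_le_norm y))
  rw [integral_comp_mul_sub_add hg hA (hφ.sub hψm) hψm hb ψ.norm_coe_le_norm,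
    integral_comp_mul_sub_add hk hB (hφ.sub hψm) hψm hb ψ.norm_coe_le_norm]
  have h2 : ∫ x, ψ (g x) * A x ∂μ = ∫ y, ψ (k y) * B y ∂ν := h ψ.toContinuousMap
  rw [h2, add_sub_add_right_eq_sub]
  refine (enorm_sub_le).trans (le_trans ?_ hψ)
  exact add_le_add (enorm_integral_comp_mul_le hg hA (hφ.sub hψm))
    (enorm_integral_comp_mul_le hk hB (hφ.sub hψm))

/-- The weak form of `t M_{φ ∘ g} = M_{φ ∘ g} t` for bounded Borel `φ`. It is needed for
coefficients of `α_g(m)`, which are only Borel in `g`, and for indicators. -/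
lemma ConcreteModule.integral_equivariant {X Y : ConcreteModule G} (t : X ⟶ Y) {φ : G → ℂ}
    (hφ : Measurable φ) {C : ℝ} (hC : ∀ y, ‖φ y‖ ≤ C) (f : X.L2) (h : Y.L2) :
    ∫ x, φ (X.g x) * (star ((ContinuousLinearMap.adjoint (op t) h : X.L2) x) * f x) ∂X.μ =
      ∫ y, φ (Y.g y) * (star (h y) * (op t f : Y.L2) y) ∂Y.μ := by
  have hint : ∀ {Z : ConcreteModule G} (a b : Z.L2), Integrable (fun z => star (a z) * b z) Z.μ := by
    intro Z a b
    refine (L2.integrable_inner (𝕜 := ℂ) a b).congr (Filter.Eventually.of_forall fun z => ?_)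
    simp [mul_comm]
  have hact : ∀ {Z : ConcreteModule G} (a b : Z.L2) (ψ : C(G, ℂ)),
      ⟪a, Z.act ψ b⟫_ℂ = ∫ z, ψ (Z.g z) * (star (a z) * b z) ∂Z.μ := by
    intro Z a b ψ
    rw [L2.inner_def]
    refine integral_congr_ae ?_
    filter_upwards [Z.act_coeFn ψ b] with z hz
    rw [hz]
    simp only [RCLike.inner_apply, RCLike.star_def]
    ring
  refine integral_comp_mul_eq_of_continuous X.measurable_g Y.measurable_g (hint _ _) (hint _ _)
    (fun ψ => ?_) hφ hC
  rw [← hact, ← hact, ContinuousLinearMap.adjoint_inner_left]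
  exact congrArg (fun A : X.L2 →L[ℂ] Y.L2 => ⟪h, A f⟫_ℂ) (t.2 ψ)

end Borel

/-! ### Intertwiners from equivariant maps, and disjoint supports -/

section Intertwine

variable {G : Type u} [Group G] [TopologicalSpace G] [MeasurableSpace G]
  [CompactSpace G] [T2Space G] [SecondCountableTopology G] [BorelSpace G]
  {H : Type v} [NormedAddCommGroup H] [InnerProductSpace ℂ H] [CompleteSpace H]
  [TopologicalSpace.SeparableSpace H] {M : VonNeumannAlgebra H} {θ : GKernel G M}

/-- `1 ⊗ t` intertwines `σ_X` and `σ_Y` for an equivariant `t`. -/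
lemma lmap_comp_sigmaOp (α : BorelLift θ) {X Y : ConcreteModule G} (t : X ⟶ Y) (m : M.Elem) :
    HilbertTensor.lmap H (ConcreteModule.op t) ∘L sigmaOp α X m =
      sigmaOp α Y m ∘L HilbertTensor.lmap H (ConcreteModule.op t) := by
  refine HilbertTensor.clm_ext_inner fun ξ f η h => ?_
  rw [ContinuousLinearMap.comp_apply, ContinuousLinearMap.comp_apply,
    ← ContinuousLinearMap.adjoint_inner_left, HilbertTensor.adjoint_lmap, HilbertTensor.lmap_tmul,
    HilbertTensor.lmap_tmul, inner_sigmaOp, inner_sigmaOp]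
  refine ConcreteModule.integral_equivariant t (α.borel.measurable_inner m ξ η)
    (C := ‖η‖ * (‖m‖ * ‖ξ‖)) (fun g => ?_) f h
  refine (norm_inner_le_norm _ _).trans (mul_le_mul_of_nonneg_left ?_ (norm_nonneg _))
  exact ContinuousLinearMap.le_of_opNorm_le _ (VonNeumannAlgebra.norm_aut_le _ m) ξ

/-- There are no nonzero equivariant maps between modules supported on disjoint Borel sets. -/
lemma ConcreteModule.hom_eq_zero_of_disjoint {X Y : ConcreteModule G} (t : X ⟶ Y) {E : Set G}
    (hE : MeasurableSet E) (hX : ∀ᵐ x ∂X.μ, X.g x ∈ E) (hY : ∀ᵐ y ∂Y.μ, Y.g y ∉ E) :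
    op t = 0 := by
  ext1 f
  refine ext_inner_left ℂ fun h => ?_
  -- The indicator of `E` acts as `1` on `L²X` and as `0` on `L²Y`, so the identity reads `⟪h, t f⟫
  -- = 0`.
  have h1 := integral_equivariant t (φ := E.indicator 1) (measurable_one.indicator hE) (C := 1)
    (fun y => by by_cases hy : y ∈ E <;> simp [hy]) f h
  have h2 : ∫ y, E.indicator (1 : G → ℂ) (Y.g y) * (star (h y) * (op t f : Y.L2) y) ∂Y.μ = 0 := by
    rw [← integral_zero]
    refine integral_congr_ae ?_
    filter_upwards [hY] with y hy
    simp [hy]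
  rw [h2] at h1
  rw [← ContinuousLinearMap.adjoint_inner_left, L2.inner_def, zero_apply,
    inner_zero_right, ← h1]
  refine integral_congr_ae ?_
  filter_upwards [hX] with x hx
  simp [hx, mul_comm]

end Intertwine

/-! ### Monotone families in a von Neumann algebra -/

section Monotone

open Filter Topology ComplexOrder

variable {H : Type v} [NormedAddCommGroup H] [InnerProductSpace ℂ H] [CompleteSpace H]

lemma le_iff_inner_nonneg {a b : H →L[ℂ] H} : a ≤ b ↔ ∀ ξ, 0 ≤ ⟪ξ, (b - a) ξ⟫_ℂ := by
  rw [ContinuousLinearMap.le_def]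
  refine ⟨fun h ξ => h.inner_nonneg_right ξ, fun h => ?_⟩
  rw [ContinuousLinearMap.isPositive_iff_complex]
  intro ξ
  have h1 := Complex.nonneg_iff.1 (h ξ)
  rw [← inner_conj_symm ((b - a) ξ) ξ]
  generalize ⟪ξ, (b - a) ξ⟫_ℂ = z at h1
  exact ⟨Complex.ext (by simp) (by simp [← h1.2]), by simpa using h1.1⟩

lemma le_of_tendsto_inner {ι : Type*} {l : Filter ι} [l.NeBot] {x : ι → H →L[ℂ] H}
    {a b : H →L[ℂ] H} (hx : ∀ᶠ i in l, x i ≤ b)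
    (h : ∀ ξ, Tendsto (fun i => ⟪ξ, x i ξ⟫_ℂ) l (𝓝 ⟪ξ, a ξ⟫_ℂ)) : a ≤ b := by
  rw [le_iff_inner_nonneg]
  intro ξ
  have h1 : Tendsto (fun i => ⟪ξ, (b - x i) ξ⟫_ℂ) l (𝓝 ⟪ξ, (b - a) ξ⟫_ℂ) := by
    simp only [sub_apply, inner_sub_right]
    exact tendsto_const_nhds.sub (h ξ)
  exact ge_of_tendsto h1 (hx.mono fun i hi => le_iff_inner_nonneg.1 hi ξ)

/-- Closed discs are compact, so bounded scalars converge along `u`; the limit is a bounded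
functional, represented by a vector by Riesz. -/
lemma tendsto_inner_of_ultrafilter_bounded {ι : Type*} (u : Ultrafilter ι) {v : ι → H} {C : ℝ}
    (hC : ∀ᶠ i in u, ‖v i‖ ≤ C) :
    ∃ a : H, ‖a‖ ≤ C ∧ ∀ η, Tendsto (fun i => ⟪η, v i⟫_ℂ) u (𝓝 ⟪η, a⟫_ℂ) := by
  have hlim : ∀ η, ∃ z : ℂ, ‖z‖ ≤ C * ‖η‖ ∧ Tendsto (fun i => ⟪v i, η⟫_ℂ) u (𝓝 z) := fun η => by
    have h1 : (u.map fun i => ⟪v i, η⟫_ℂ : Filter ℂ) ≤ 𝓟 (Metric.closedBall 0 (C * ‖η‖)) := by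
      rw [le_principal_iff]
      change ∀ᶠ i in (u : Filter ι), _
      filter_upwards [hC] with i hi
      rw [mem_closedBall_zero_iff]
      exact (norm_inner_le_norm _ _).trans (mul_le_mul_of_nonneg_right hi (norm_nonneg _))
    obtain ⟨z, hz, hz'⟩ := (isCompact_closedBall (0 : ℂ) (C * ‖η‖)).ultrafilter_le_nhds _ h1
    exact ⟨z, by simpa using hz, hz'⟩
  choose z hz hz' using hlim
  let l : H →ₗ[ℂ] ℂ :=
    { toFun := z
      map_add' := fun η η' => tendsto_nhds_unique (hz' (η + η'))
        (by simpa only [inner_add_right] using (hz' η).add (hz' η'))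
      map_smul' := fun c η => tendsto_nhds_unique (hz' (c • η))
        (by simpa only [inner_smul_right, smul_eq_mul, RingHom.id_apply] using (hz' η).const_smul c) }
  let L : H →L[ℂ] ℂ := l.mkContinuous C hz
  refine ⟨(InnerProductSpace.toDual ℂ H).symm L, ?_, fun η => ?_⟩
  · rw [LinearIsometryEquiv.norm_map]
    obtain ⟨i, hi⟩ := hC.exists
    exact l.mkContinuous_norm_le ((norm_nonneg _).trans hi) hz
  · rw [← inner_conj_symm, InnerProductSpace.toDual_symm_apply]
    change Tendsto _ _ (𝓝 (starRingEnd ℂ (z η)))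
    simpa only [Function.comp_def, inner_conj_symm] using
      (Complex.continuous_conj.tendsto _).comp (hz' η)

/-- Bounded families of operators converge weakly along ultrafilters. -/
lemma exists_weak_limit {ι : Type*} (u : Ultrafilter ι) {y : ι → H →L[ℂ] H} {C : ℝ}
    (hC : ∀ᶠ i in u, ‖y i‖ ≤ C) :
    ∃ a : H →L[ℂ] H, ∀ ξ η, Tendsto (fun i => ⟪η, y i ξ⟫_ℂ) u (𝓝 ⟪η, a ξ⟫_ℂ) := by
  have h1 : ∀ ξ, ∃ a : H, ‖a‖ ≤ C * ‖ξ‖ ∧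
      ∀ η, Tendsto (fun i => ⟪η, y i ξ⟫_ℂ) u (𝓝 ⟪η, a⟫_ℂ) := fun ξ =>
    tendsto_inner_of_ultrafilter_bounded u (hC.mono fun i hi => (y i).le_of_opNorm_le hi ξ)
  choose a ha ha' using h1
  let A : H →ₗ[ℂ] H :=
    { toFun := a
      map_add' := fun ξ ξ' => ext_inner_left ℂ fun η => tendsto_nhds_unique (ha' (ξ + ξ') η)
        (by simpa only [map_add, inner_add_right] using (ha' ξ η).add (ha' ξ' η))
      map_smul' := fun c ξ => ext_inner_left ℂ fun η => tendsto_nhds_unique (ha' (c • ξ) η)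
        (by simpa only [map_smul, inner_smul_right, RingHom.id_apply] using (ha' ξ η).const_mul c) }
  exact ⟨A.mkContinuous C ha, ha'⟩

namespace VonNeumannAlgebra

variable {M : VonNeumannAlgebra H}

lemma mem_of_tendsto_inner {ι : Type*} {l : Filter ι} [l.NeBot] {y : ι → H →L[ℂ] H}
    {a : H →L[ℂ] H} (hy : ∀ i, y i ∈ M)
    (h : ∀ ξ η, Tendsto (fun i => ⟪η, y i ξ⟫_ℂ) l (𝓝 ⟪η, a ξ⟫_ℂ)) : a ∈ M := by
  refine mem_of_commutes fun b hb => ?_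
  ext ξ
  refine ext_inner_left ℂ fun η => ?_
  have h1 := h ξ (ContinuousLinearMap.adjoint b η)
  have h2 := h (b ξ) η
  refine tendsto_nhds_unique ?_ h2
  rw [ContinuousLinearMap.adjoint_inner_left] at h1
  refine h1.congr fun i => ?_
  rw [ContinuousLinearMap.adjoint_inner_left]
  exact congrArg (fun A : H →L[ℂ] H => ⟪η, A ξ⟫_ℂ) (commutes_of_mem (hy i) hb)

/-- `m` is the least upper bound in `M` of the family `x`. -/
def IsSup {ι : Type*} (x : ι → M.Elem) (m : M.Elem) : Prop :=
  (∀ i, (x i : H →L[ℂ] H) ≤ m) ∧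
    ∀ n : M.Elem, (∀ i, (x i : H →L[ℂ] H) ≤ n) → (m : H →L[ℂ] H) ≤ n

lemma norm_sub_le_of_le {a b c : H →L[ℂ] H} (h1 : a ≤ b) (h2 : b ≤ c) : ‖c - b‖ ≤ ‖c - a‖ :=
  CStarAlgebra.norm_le_norm_of_nonneg_of_le (sub_nonneg.2 h2) (sub_le_sub_left h1 c)

/-- An increasing directed family in `M` converges weakly to its least upper bound. -/
lemma IsSup.tendsto_inner {ι : Type*} [Preorder ι] [IsDirectedOrder ι] [Nonempty ι]
    {x : ι → M.Elem} {m : M.Elem} (hx : Monotone fun i => (x i : H →L[ℂ] H)) (hm : IsSup x m)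
    (ξ η : H) :
    Tendsto (fun i => ⟪η, (x i : H →L[ℂ] H) ξ⟫_ℂ) atTop (𝓝 ⟪η, (m : H →L[ℂ] H) ξ⟫_ℂ) := by
  rw [tendsto_iff_ultrafilter]
  intro u hu
  let i₀ : ι := Classical.arbitrary ι
  -- From `i₀` on, `0 ≤ m - x i ≤ m - x i₀` bounds the family. Its weak limit `a` lies in `M` and
  -- satisfies `x i ≤ a ≤ m`, so leastness of `m` gives `a = m`.
  obtain ⟨a, ha⟩ := exists_weak_limit u (y := fun i => (x i : H →L[ℂ] H))
    (C := ‖(m : H →L[ℂ] H)‖ + ‖(m : H →L[ℂ] H) - x i₀‖) (by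
      filter_upwards [hu (eventually_ge_atTop i₀)] with i hi
      calc ‖(x i : H →L[ℂ] H)‖ = ‖(m : H →L[ℂ] H) - (m - x i)‖ := by rw [sub_sub_cancel]
        _ ≤ _ := (norm_sub_le _ _).trans
          (add_le_add_right (norm_sub_le_of_le (hx hi) (hm.1 i)) _))
  have haM : a ∈ M := mem_of_tendsto_inner (fun i => (x i).2) ha
  have h1 : a ≤ m := le_of_tendsto_inner (Eventually.of_forall hm.1) fun ξ => ha ξ ξ
  have h2 : ∀ i, (x i : H →L[ℂ] H) ≤ a := fun i => by
    rw [← neg_le_neg_iff]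
    refine le_of_tendsto_inner (l := (u : Filter ι)) (x := fun i => -(x i : H →L[ℂ] H)) ?_
      fun ξ => ?_
    · filter_upwards [hu (eventually_ge_atTop i)] with j hj
      exact neg_le_neg (hx hj)
    · simpa using (ha ξ ξ).neg
  have h3 : (m : H →L[ℂ] H) = a := le_antisymm (hm.2 ⟨a, haM⟩ h2) h1
  rw [h3]
  exact ha ξ η

/-- Recursively, take an upper bound of the previous term and of a threshold beyond which the next
property holds. -/
lemma exists_monotone_seq {ι : Type*} [Preorder ι] [IsDirectedOrder ι] [Nonempty ι]
    {P : ℕ → ι → Prop} (hP : ∀ n, ∀ᶠ i in atTop, P n i) : ∃ g : ℕ → ι, Monotone g ∧ ∀ n, P n (g n) := by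
  choose e he using fun n => eventually_atTop.1 (hP n)
  choose s hs₁ hs₂ using fun i j : ι => exists_ge_ge i j
  let g : ℕ → ι := fun n => Nat.rec (e 0) (fun n i => s i (e (n + 1))) n
  refine ⟨g, monotone_nat_of_le_succ fun n => hs₁ _ _, fun n => ?_⟩
  cases n with
  | zero => exact he 0 _ le_rfl
  | succ n => exact he (n + 1) _ (hs₂ _ _)

/-- On a separable space, the least upper bound of an increasing directed family is already the
least upper bound of an increasing sequence in it. -/
lemma IsSup.exists_seq [TopologicalSpace.SeparableSpace H] {ι : Type*} [Preorder ι]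
    [IsDirectedOrder ι] [Nonempty ι] {x : ι → M.Elem} {m : M.Elem}
    (hx : Monotone fun i => (x i : H →L[ℂ] H)) (hm : IsSup x m) :
    ∃ g : ℕ → ι, Monotone g ∧ IsSup (fun n => x (g n)) m := by
  let e : ℕ → H := TopologicalSpace.denseSeq H
  -- Diagonal choice: the `n`-th term is within `1 / (n + 1)` of `m` on the quadratic forms of `e 0,
  -- …, e n`. Positivity of a bounded operator can be tested on the dense sequence `e`.
  obtain ⟨g, hg, hg'⟩ := exists_monotone_seq (ι := ι) (P := fun n i => ∀ k ∈ Finset.range (n + 1),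
    dist ⟪e k, (x i : H →L[ℂ] H) (e k)⟫_ℂ ⟪e k, (m : H →L[ℂ] H) (e k)⟫_ℂ < 1 / ((n : ℝ) + 1))
    (fun n => (Finset.eventually_all _).2 fun k _ =>
      (Metric.tendsto_nhds.1 (hm.tendsto_inner hx (e k) (e k))) _ (by positivity))
  refine ⟨g, hg, fun n => hm.1 _, fun b hb => ?_⟩
  rw [le_iff_inner_nonneg]
  intro ξ
  refine (TopologicalSpace.denseRange_denseSeq H).induction_on
    (p := fun ξ => 0 ≤ ⟪ξ, ((b : H →L[ℂ] H) - m) ξ⟫_ℂ) ξ ?_ fun k => ?_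
  · exact isClosed_le continuous_const
      (Continuous.inner continuous_id ((b : H →L[ℂ] H) - m).continuous)
  · have h1 : Tendsto (fun n => ⟪e k, (x (g n) : H →L[ℂ] H) (e k)⟫_ℂ) atTop
        (𝓝 ⟪e k, (m : H →L[ℂ] H) (e k)⟫_ℂ) := by
      rw [tendsto_iff_dist_tendsto_zero]
      refine squeeze_zero' (Eventually.of_forall fun n => dist_nonneg) ?_
        tendsto_one_div_add_atTop_nhds_zero_nat
      filter_upwards [eventually_ge_atTop k] with n hn
      exact (hg' n k (Finset.mem_range.2 (by omega))).le
    have h2 : Tendsto (fun n => ⟪e k, ((b : H →L[ℂ] H) - x (g n)) (e k)⟫_ℂ) atTop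
        (𝓝 ⟪e k, ((b : H →L[ℂ] H) - m) (e k)⟫_ℂ) := by
      simp only [sub_apply, inner_sub_right]
      exact tendsto_const_nhds.sub h1
    exact ge_of_tendsto' h2 fun n => le_iff_inner_nonneg.1 (hb n) _

/-- Star homomorphisms between von Neumann algebras are order preserving. -/
lemma starAlgHom_mono (φ : M.Elem →⋆ₐ[ℂ] M.Elem) {x y : M.Elem} (h : (x : H →L[ℂ] H) ≤ y) :
    (φ x : H →L[ℂ] H) ≤ φ y := by
  let s : H →L[ℂ] H := CFC.sqrt ((y : H →L[ℂ] H) - x)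
  have hs : s * s = (y : H →L[ℂ] H) - x := CFC.sqrt_mul_sqrt_self _ (sub_nonneg.2 h)
  have hs' : star s = s := (IsSelfAdjoint.of_nonneg (CFC.sqrt_nonneg ((y : H →L[ℂ] H) - x))).star_eq
  -- The square root stays in `M`, so `y - x = t* t` with `t ∈ M`, a form that `φ` preserves.
  have hsM : s ∈ M := mem_of_commutes fun b hb => by
    have h1 : Commute ((y : H →L[ℂ] H) - x) b := (commutes_of_mem (sub_mem y.2 x.2) hb).symm
    have h2 : Commute s b := h1.cfcₙ_nnreal _
    exact h2.eq.symm
  let t : M.Elem := ⟨s, hsM⟩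
  have ht : y - x = star t * t := Subtype.ext (by
    change (y : H →L[ℂ] H) - x = star s * s
    rw [hs', hs])
  have h3 : φ y - φ x = star (φ t) * φ t := by rw [← map_sub, ht, map_mul, map_star]
  have h4 : (φ y : H →L[ℂ] H) - φ x = star (φ t : H →L[ℂ] H) * (φ t : H →L[ℂ] H) :=
    congrArg Subtype.val h3
  rw [← sub_nonneg, h4]
  exact star_mul_self_nonneg _

/-- An automorphism and its inverse are both monotone, so normality is automatic. -/
lemma IsSup.map_aut {ι : Type*} {x : ι → M.Elem} {m : M.Elem} (hm : IsSup x m) (a : M.Aut) :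
    IsSup (fun i => a (x i)) (a m) := by
  refine ⟨fun i => starAlgHom_mono (a : M.Elem →⋆ₐ[ℂ] M.Elem) (hm.1 i), fun n hn => ?_⟩
  have h1 := hm.2 (a.symm n) fun i => by
    have := starAlgHom_mono (a.symm : M.Elem →⋆ₐ[ℂ] M.Elem) (hn i)
    simpa using this
  have := starAlgHom_mono (a : M.Elem →⋆ₐ[ℂ] M.Elem) h1
  simpa using this

/-- A star homomorphism on a separable space is normal as soon as it is weakly continuous along
increasing sequences. -/
lemma isNormalHom_of_seq [TopologicalSpace.SeparableSpace H] (ρ : M.Elem →⋆ₐ[ℂ] M.Elem)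
    (h : ∀ (x : ℕ → M.Elem) (m : M.Elem), Monotone (fun n => (x n : H →L[ℂ] H)) → IsSup x m →
      ∀ ξ, Tendsto (fun n => ⟪ξ, (ρ (x n) : H →L[ℂ] H) ξ⟫_ℂ) atTop
        (𝓝 ⟪ξ, (ρ m : H →L[ℂ] H) ξ⟫_ℂ)) : IsNormalHom ρ := by
  rintro D m hD - hdir ⟨hm₁, hm₂⟩
  refine ⟨fun x hx => starAlgHom_mono ρ (hm₁ x hx), fun n hn => ?_⟩
  let _ : Preorder D := Preorder.lift fun d : D => ((d : M.Elem) : H →L[ℂ] H)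
  have : Nonempty D := hD.to_subtype
  have : IsDirectedOrder D := ⟨fun a b => by
    obtain ⟨c, hc, h1, h2⟩ := hdir a a.2 b b.2
    exact ⟨⟨c, hc⟩, h1, h2⟩⟩
  obtain ⟨g, hg, hg'⟩ := IsSup.exists_seq (x := fun d : D => (d : M.Elem)) (m := m)
    (fun a b hab => hab) ⟨fun d => hm₁ d d.2, fun b hb => hm₂ b fun x hx => hb ⟨x, hx⟩⟩
  exact le_of_tendsto_inner (Eventually.of_forall fun k => hn _ (g k).2)
    (h _ m (fun a b hab => hg hab) hg')

end VonNeumannAlgebra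

end Monotone

/-! ### The endomorphisms `ρ_X` and the functor `F` -/

section Rho

open Filter Topology VonNeumannAlgebra

variable {G : Type u} [Group G] [TopologicalSpace G] [MeasurableSpace G]
  {H : Type v} [NormedAddCommGroup H] [InnerProductSpace ℂ H] [CompleteSpace H]
  [TopologicalSpace.SeparableSpace H] {M : VonNeumannAlgebra H} {S : StandardForm M}
  {θ : GKernel G M} (α : BorelLift θ) (X : ConcreteModule G)

/-- `σ_X` is weakly continuous along increasing sequences. -/
lemma tendsto_inner_sigmaOp {x : ℕ → M.Elem} {m : M.Elem}
    (hx : Monotone fun n => (x n : H →L[ℂ] H)) (hm : IsSup x m) (ζ : HilbertTensor H X.L2) :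
    Tendsto (fun n => ⟪ζ, sigmaOp α X (x n) ζ⟫_ℂ) atTop (𝓝 ⟪ζ, sigmaOp α X m ζ⟫_ℂ) := by
  simp only [inner_sigmaOp_left]
  let f : Lp H 2 X.μ := tensorToLp X.μ ζ
  let C : ℝ := ‖m‖ + ‖(m : H →L[ℂ] H) - x 0‖
  have hC : ∀ n, ‖x n‖ ≤ C := fun n => by
    calc ‖(x n : H →L[ℂ] H)‖ = ‖(m : H →L[ℂ] H) - (m - x n)‖ := by rw [sub_sub_cancel]
      _ ≤ _ := (norm_sub_le _ _).trans
        (add_le_add_right (norm_sub_le_of_le (hx (Nat.zero_le n)) (hm.1 n)) _)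
  -- The dominating function is `C ‖f z‖²`. Pointwise convergence holds since each `α_{g(z)}`
  -- preserves the supremum.
  refine tendsto_integral_of_dominated_convergence (fun z => C * RCLike.re ⟪f z, f z⟫_ℂ)
    (fun n => ?_) ((L2.integrable_inner f f).re.const_mul C) (fun n => ?_) ?_
  · refine (L2.integrable_inner f (tensorToLp X.μ (sigmaOp α X (x n) ζ))).1.congr ?_
    filter_upwards [tensorToLp_sigmaOp α X (x n) ζ] with z hz
    rw [hz]
  · refine Eventually.of_forall fun z => ?_
    rw [inner_self_eq_norm_mul_norm, mul_left_comm]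
    exact (norm_inner_le_norm _ _).trans (mul_le_mul_of_nonneg_left
      (ContinuousLinearMap.le_of_opNorm_le _ ((norm_aut_le _ _).trans (hC n)) _) (norm_nonneg _))
  · refine Eventually.of_forall fun z => ?_
    exact (hm.map_aut (α.toFun (X.g z))).tendsto_inner
      (fun i j hij => starAlgHom_mono (α.toFun (X.g z) : M.Elem →⋆ₐ[ℂ] M.Elem) (hx hij)) _ _

variable (U : RightModularUnitary S X.L2)

lemma rhoOp_mem (m : M.Elem) : rhoOp α X U m ∈ M :=
  U.conj_mem U fun _ hb => sigmaOp_comp_rmap α X hb m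

/-- `ρ_X` as a star homomorphism. -/
def rhoHom : M.Elem →⋆ₐ[ℂ] M.Elem where
  toFun m := ⟨rhoOp α X U m, rhoOp_mem α X U m⟩
  map_one' := Subtype.ext <| by
    ext ξ
    simp [rhoOp, sigmaOp_one]
  map_mul' m n := Subtype.ext <| by
    ext ξ
    simp [rhoOp, sigmaOp_mul]
  map_zero' := Subtype.ext <| by
    have h := sigmaOp_smul α X 0 0
    rw [zero_smul, zero_smul] at h
    ext ξ
    simp [rhoOp, h]
  map_add' m n := Subtype.ext <| by
    ext ξ
    simp [rhoOp, sigmaOp_add]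
  commutes' c := Subtype.ext <| by
    ext ξ
    rw [Algebra.algebraMap_eq_smul_one]
    simp [rhoOp, sigmaOp_smul, sigmaOp_one]
  map_star' m := Subtype.ext <| by
    change rhoOp α X U (star m) = ContinuousLinearMap.adjoint (rhoOp α X U m)
    rw [rhoOp, rhoOp, ContinuousLinearMap.adjoint_comp, ContinuousLinearMap.adjoint_comp,
      U.adjoint_op, U.adjoint_opAdj, sigmaOp_star, ContinuousLinearMap.comp_assoc]

@[simp]
lemma coe_rhoHom (m : M.Elem) : (rhoHom α X U m : H →L[ℂ] H) = rhoOp α X U m := rfl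

/-- `ρ_X` as an object of `End(M)`. -/
def rhoEnd : M.NormalEnd where
  toHom := rhoHom α X U
  normal := isNormalHom_of_seq _ fun x m hx hm ξ => by
    simp only [coe_rhoHom, rhoOp, ContinuousLinearMap.comp_apply]
    have h : ∀ A : HilbertTensor H X.L2 →L[ℂ] HilbertTensor H X.L2,
        ⟪ξ, U.op (A (U.opAdj ξ))⟫_ℂ = ⟪U.opAdj ξ, A (U.opAdj ξ)⟫_ℂ := fun A => by
      rw [← inner_conj_symm, U.inner_op, inner_conj_symm]
    simp only [h]
    exact tendsto_inner_sigmaOp α X hx hm _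

end Rho

section Functor

open VonNeumannAlgebra

variable {G : Type u} [Group G] [TopologicalSpace G] [MeasurableSpace G]
  [CompactSpace G] [T2Space G] [SecondCountableTopology G] [BorelSpace G]
  {H : Type v} [NormedAddCommGroup H] [InnerProductSpace ℂ H] [CompleteSpace H]
  [TopologicalSpace.SeparableSpace H] {M : VonNeumannAlgebra H} {S : StandardForm M}
  {θ : GKernel G M} (α : BorelLift θ) (U : (X : ConcreteModule.{u} G) → RightModularUnitary S X.L2)

/-- `F(t) = U_Y (1 ⊗ t) U_X*`. -/
def rhoMapOp {X Y : ConcreteModule.{u} G} (t : X ⟶ Y) : H →L[ℂ] H :=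
  (U Y).op ∘L HilbertTensor.lmap H (ConcreteModule.op t) ∘L (U X).opAdj

lemma rhoMapOp_mem {X Y : ConcreteModule.{u} G} (t : X ⟶ Y) : rhoMapOp U t ∈ M :=
  (U X).conj_mem (U Y) fun b _ => HilbertTensor.lmap_comp_rmap _ b

/-- The functor `F`. -/
def rhoFunctor : ConcreteModule.{u} G ⥤ M.NormalEnd where
  obj X := rhoEnd α X (U X)
  map {X Y} t := (⟨⟨rhoMapOp U t, rhoMapOp_mem U t⟩, fun m => Subtype.ext <| by
    change rhoMapOp U t ∘L rhoOp α X (U X) m = rhoOp α Y (U Y) m ∘L rhoMapOp U t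
    ext ξ
    have h := congrArg (fun A => (U Y).op (A ((U X).opAdj ξ))) (lmap_comp_sigmaOp α t m)
    simpa [rhoMapOp, rhoOp] using h⟩ : intertwiners (rhoEnd α X (U X)) (rhoEnd α Y (U Y)))
  map_id X := Subtype.ext <| Subtype.ext <| by
    change (U X).op ∘L HilbertTensor.lmap H (ContinuousLinearMap.id ℂ X.L2) ∘L (U X).opAdj = 1
    ext ξ
    simp [HilbertTensor.lmap_id]
  map_comp {X Y Z} s t := Subtype.ext <| Subtype.ext <| by
    change (U Z).op ∘L HilbertTensor.lmap H (ConcreteModule.op t ∘L ConcreteModule.op s) ∘L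
      (U X).opAdj = rhoMapOp U t ∘L rhoMapOp U s
    ext ξ
    simp [rhoMapOp, HilbertTensor.lmap_comp]

lemma elem_rhoFunctor_map {X Y : ConcreteModule.{u} G} (t : X ⟶ Y) :
    (NormalEnd.elem ((rhoFunctor α U).map t) : H →L[ℂ] H) = rhoMapOp U t := rfl

instance : (rhoFunctor α U).Additive where
  map_add {X Y} {s t} := Subtype.ext <| Subtype.ext <| by
    change (U Y).op ∘L HilbertTensor.lmap H (ConcreteModule.op s + ConcreteModule.op t) ∘L
      (U X).opAdj = rhoMapOp U s + rhoMapOp U t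
    ext ξ
    simp [rhoMapOp, HilbertTensor.lmap_add]

instance : (rhoFunctor α U).Linear ℂ where
  map_smul {X Y} t c := Subtype.ext <| Subtype.ext <| by
    change (U Y).op ∘L HilbertTensor.lmap H (c • ConcreteModule.op t) ∘L (U X).opAdj =
      c • rhoMapOp U t
    ext ξ
    simp [rhoMapOp, HilbertTensor.lmap_smul]

lemma rhoFunctor_map_dagger {X Y : ConcreteModule.{u} G} (t : X ⟶ Y) :
    (rhoFunctor α U).map (ConcreteModule.dagger t) =
      NormalEnd.dagger ((rhoFunctor α U).map t) := by
  refine Subtype.ext <| Subtype.ext ?_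
  change (U X).op ∘L HilbertTensor.lmap H (ContinuousLinearMap.adjoint (ConcreteModule.op t)) ∘L
    (U Y).opAdj = ContinuousLinearMap.adjoint (rhoMapOp U t)
  rw [rhoMapOp, ContinuousLinearMap.adjoint_comp, ContinuousLinearMap.adjoint_comp,
    RightModularUnitary.adjoint_op, RightModularUnitary.adjoint_opAdj, HilbertTensor.adjoint_lmap,
    ContinuousLinearMap.comp_assoc]

lemma rhoFunctor_faithful [Nontrivial H] : (rhoFunctor α U).Faithful where
  map_injective {X Y} s t hst := Subtype.ext <| by
    have h : rhoMapOp U s = rhoMapOp U t := by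
      rw [← elem_rhoFunctor_map α, ← elem_rhoFunctor_map α, hst]
    change ConcreteModule.op s = ConcreteModule.op t
    refine HilbertTensor.lmap_injective (H := H) ?_
    ext1 ζ
    have h' := congrArg (fun A => (U Y).opAdj (A ((U X).op ζ))) h
    simpa [rhoMapOp] using h'

/-- If `F` is full, then there are no intertwiners between integrals over disjoint Borel sets. -/
lemma hasDisjointIntegrals_of_full [(rhoFunctor α U).Full] : HasDisjointIntegrals S α := by
  intro μ _ E F hE hF hμE _ hμF _ hEF UE UF T hT
  let X : ConcreteModule.{u} G := ConcreteModule.ofSubset μ E hμE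
  let Y : ConcreteModule.{u} G := ConcreteModule.ofSubset μ F hμF
  -- `UE` and `UF` need not be the unitaries defining `F`. Stripping them off gives an intertwiner
  -- `A` of `σ_X` and `σ_Y`, and conjugating with `U X` and `U Y` turns it into a morphism to which
  -- fullness applies.
  let A : HilbertTensor H X.L2 →L[ℂ] HilbertTensor H Y.L2 :=
    UF.opAdj ∘L (T : H →L[ℂ] H) ∘L UE.op
  have hA : ∀ b ∈ M.commutant, A ∘L HilbertTensor.rmap X.L2 b = HilbertTensor.rmap Y.L2 b ∘L A :=
    fun b hb => UE.opAdj_comp_comp_op UF T.2 hb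
  have hAσ : ∀ m, A ∘L sigmaOp α X m = sigmaOp α Y m ∘L A := fun m => by
    ext1 ζ
    have h := congrArg (fun B : H →L[ℂ] H => UF.opAdj (B (UE.op ζ))) (hT m)
    simpa [rhoOp, A] using h
  let T' : (rhoFunctor α U).obj X ⟶ (rhoFunctor α U).obj Y :=
    (⟨⟨(U Y).op ∘L A ∘L (U X).opAdj, (U X).conj_mem (U Y) hA⟩, fun m => Subtype.ext <| by
      change ((U Y).op ∘L A ∘L (U X).opAdj) ∘L rhoOp α X (U X) m =
        rhoOp α Y (U Y) m ∘L ((U Y).op ∘L A ∘L (U X).opAdj)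
      ext1 ξ
      have h := congrArg (fun B => (U Y).op (B ((U X).opAdj ξ))) (hAσ m)
      simpa [rhoOp] using h⟩ : intertwiners (rhoEnd α X (U X)) (rhoEnd α Y (U Y)))
  obtain ⟨t, ht⟩ := (rhoFunctor α U).map_surjective T'
  -- `X` is carried by `E`, while `μ(E ∩ F) = 0` means that `Y`, carried by `F`, lives off `E`.
  have ht0 : ConcreteModule.op t = 0 := by
    refine ConcreteModule.hom_eq_zero_of_disjoint t hE (ae_restrict_mem hE) ?_
    change ∀ᵐ y ∂μ.restrict F, y ∉ E
    rw [ae_restrict_iff' hF]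
    have h : ∀ᵐ y ∂μ, y ∉ E ∩ F := measure_eq_zero_iff_ae_notMem.1 hEF
    filter_upwards [h] with y hy hyF hyE
    exact hy ⟨hyE, hyF⟩
  have h1 : (U Y).op ∘L A ∘L (U X).opAdj = 0 := by
    have h2 : rhoMapOp U t = (U Y).op ∘L A ∘L (U X).opAdj :=
      congrArg (fun R => (NormalEnd.elem R : H →L[ℂ] H)) ht
    have h3 : HilbertTensor.lmap H (0 : X.L2 →L[ℂ] Y.L2) = 0 := by
      have h4 := HilbertTensor.lmap_smul (H := H) (0 : ℂ) (0 : X.L2 →L[ℂ] Y.L2)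
      rwa [zero_smul, zero_smul] at h4
    rw [← h2, rhoMapOp, ht0, h3]
    ext ξ
    simp
  refine Subtype.ext ?_
  ext ξ
  have h2 := congrArg (fun B : H →L[ℂ] H => UF.op ((U Y).opAdj (B ((U X).op (UE.opAdj ξ))))) h1
  simpa [A] using h2

end Functor

end

/-! ### The main theorem -/

theorem mainTheorem2
    {G : Type u} [Group G] [TopologicalSpace G] [IsTopologicalGroup G] [CompactSpace G] [T2Space G]
    [SecondCountableTopology G] [MeasurableSpace G] [BorelSpace G]
    {H : Type v} [NormedAddCommGroup H] [InnerProductSpace ℂ H] [CompleteSpace H]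
    [TopologicalSpace.SeparableSpace H]
    (M : VonNeumannAlgebra H) (hM : M.IsFactor) (hIII : M.IsTypeIII) (S : StandardForm M)
    (θ : GKernel G M) (α : BorelLift θ) :
    (∀ X : ConcreteModule.{u} G, Nonempty (RightModularUnitary S X.L2)) ∧
    ∀ U : (X : ConcreteModule.{u} G) → RightModularUnitary S X.L2,
      ∃ F : ConcreteModule.{u} G ⥤ M.NormalEnd,
        (∀ (X : ConcreteModule.{u} G) (m : M.Elem),
          ((F.obj X).toHom m : H →L[ℂ] H) = rhoOp α X (U X) m) ∧
        (∀ (X Y : ConcreteModule.{u} G) (t : X ⟶ Y),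
          (NormalEnd.elem (F.map t) : H →L[ℂ] H) =
            (U Y).op ∘L HilbertTensor.lmap H (ConcreteModule.op t) ∘L (U X).opAdj) ∧
        F.Additive ∧ F.Linear ℂ ∧
        (∀ (X Y : ConcreteModule.{u} G) (t : X ⟶ Y),
          F.map (ConcreteModule.dagger t) = NormalEnd.dagger (F.map t)) ∧
        F.Faithful ∧
        (F.Full → HasDisjointIntegrals S α ∧ θ.IsMinimal S) := by
  have := hM.1
  refine ⟨fun X => ?_, fun U => ⟨rhoFunctor α U, fun _ _ => rfl, fun _ _ _ => rfl, inferInstance,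
    inferInstance, fun _ _ t => rhoFunctor_map_dagger α U t, rhoFunctor_faithful α U,
    fun _ => ⟨hasDisjointIntegrals_of_full α U, α, hasDisjointIntegrals_of_full α U⟩⟩⟩
  have := X.separable
  have := X.nontrivial_L2
  exact nonempty_rightModularUnitary hM hIII S X.L2
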